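/- Let $n\ge 1$ and $m\ge 0$ be integers, and let $A_{n,m}$ be an annulus with $n$ marked points on its outer boundary and $m$ marked points on its inner boundary. View $A_{n,m}$ as a cylinder of height $1$ with universal cover the strip $\mathbb{U}=\mathbb{R}\times[0,1]$; the lower boundary covers the outer boundary, and the outer marked points $1,\dots,n$ lift to the points $((i-1)m,0)$ (to $(i-1,0)$ if $m=0$) and their translates by multiples of $nm$ (of $n$ if $m=0$) in the first coordinate. If $m>0$, the inner marked points lift to the points $(kn,1)$, $k\in\mathbb{Z}$. A (finite) arc of $A_{n,m}$ is a non-contractible curve without self-intersections that joins two (possibly equal) marked points and is not isotopic to a boundary segment; an asymptotic arc (Prüfer or adic arc) is a curve without self-intersections that starts at a marked point and spirals infinitely, in one of the two directions, towards the meridian of the annulus. Arcs are considered up to isotopy fixing their ends. Two arcs are compatible if they have representatives that do not intersect except possibly at their ends. A triangulation $T$ of $A_{n,m}$ is a maximal collection of pairwise compatible (finite or asymptotic) arcs. Its outer quiddity sequence is $(a_1,\dots,a_n)$, where $a_i$ is the number of triangles of the preimage of $T$ in $\mathbb{U}$ that are incident with the lift of the $i$-th outer marked point; the sides of these triangles are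 boundary segments or lifted arcs, and one of the vertices may be one of the two ends $\pm\infty$ of the strip. An infinite frieze is an array $(m_{ij})_{i,j\in\mathbb{Z},\, j\ge i-2}$ of integers with $m_{i,i-2}=0$, $m_{i,i-1}=1$, $m_{ij}>0$ for $i\le j$, and $m_{ij}m_{i+1,j+1}-m_{i+1,j}m_{i,j+1}=1$ for all $j\ge i-1$. Theorem. For every triangulation $T$ of $A_{n,m}$ with outer quiddity sequence $(a_1,\dots,a_n)$ there is an infinite frieze $(m_{ij})$ with $m_{i+n,i+n}=m_{ii}$ for all $i\in\mathbb{Z}$ and $m_{ii}=a_i$ for $1\le i\le n$; that is, $(a_1,\dots,a_n)$ is the quiddity sequence of a periodic infinite frieze. -/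

import Mathlib

open Filter Topology

noncomputable section

namespace AnnulusFrieze

/-! ## Infinite friezes -/

/-- An infinite frieze of positive integers: an array `(F i j)` indexed by pairs with `i - 2 ≤ j`,
with a row of zeros, a row of ones, positive entries below, and the unimodular rule for every
diamond of the array. The values `F i j` with `j < i - 2` play no role. -/
structure IsInfiniteFrieze (F : ℤ → ℤ → ℤ) : Prop where
  zeros : ∀ i, F i (i - 2) = 0
  ones : ∀ i, F i (i - 1) = 1
  pos : ∀ i j, i ≤ j → 0 < F i j
  unimodular : ∀ i j, i - 1 ≤ j → F i j * F (i + 1) (j + 1) - F (i + 1) j * F i (j + 1) = 1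

/-- The tuple `(a 0, …, a (n - 1))`, in the usual numbering `(a_1, …, a_n)`, is the quiddity
sequence of an infinite frieze of period `n`: the quiddity row `i ↦ F i i` has period `n` and
its entries in the positions `1, …, n` are those of the tuple. -/
def DefinesPeriodicInfiniteFrieze {n : ℕ} (a : Fin n → ℕ) : Prop :=
  ∃ F : ℤ → ℤ → ℤ, IsInfiniteFrieze F ∧ (∀ i : ℤ, F (i + n) (i + n) = F i i) ∧
    ∀ i : Fin n, F ((i : ℤ) + 1) ((i : ℤ) + 1) = (a i : ℤ)

/-! ## The annulus and its universal cover

The annulus `A_{n,m}` is the cylinder of height `1` whose circumference is `n * m`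
(`n` if `m = 0`). Its universal cover is the strip `ℝ × [0, 1]`; the lower boundary covers the
outer boundary of the annulus, the upper one the inner boundary. -/

/-- The circumference of the cylinder. -/
def period (n m : ℕ) : ℝ := if m = 0 then (n : ℝ) else (n : ℝ) * m

/-- The covering map from the strip to the cylinder. -/
def cover (n m : ℕ) (p : ℝ × ℝ) : AddCircle (period n m) × ℝ :=
  ((p.1 : AddCircle (period n m)), p.2)

/-- The deck transformation with index `j`. -/
def deck (n m : ℕ) (j : ℤ) (p : ℝ × ℝ) : ℝ × ℝ := (p.1 + j * period n m, p.2)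

/-- The interior of the strip. -/
def openStrip : Set (ℝ × ℝ) := {p | 0 < p.2 ∧ p.2 < 1}

/-- The possible ends of a lifted arc: the marked points on the lower and on the upper boundary
of the strip, and the two ends `±∞` of the strip, to which the lifts of curves that spiral
infinitely around the meridian tend. -/
inductive Vertex : Type
  | lower (k : ℤ)
  | upper (k : ℤ)
  | posInf
  | negInf

namespace Vertex

/-- `v` is a marked point of the strip (there are none on the upper boundary if `m = 0`). -/
def IsMarked (m : ℕ) : Vertex → Prop
  | lower _ => True
  | upper _ => m ≠ 0
  | posInf => False
  | negInf => False

/-- `v` is one of the two ends `±∞` of the strip. -/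
def IsInfinite : Vertex → Prop
  | lower _ => False
  | upper _ => False
  | posInf => True
  | negInf => True

/-- The filter of neighbourhoods of `v` in the strip. The lower marked points are the points
`(k m, 0)`, or `(k, 0)` if `m = 0`; the upper ones are the points `(k n, 1)`. Near `±∞` the first
coordinate tends to `±∞` and the height to that of the meridian, `1 / 2`. -/
def toFilter (n m : ℕ) : Vertex → Filter (ℝ × ℝ)
  | lower k => 𝓝 ((k : ℝ) * (if m = 0 then 1 else (m : ℝ)), 0)
  | upper k => 𝓝 ((k : ℝ) * n, 1)
  | posInf => atTop ×ˢ 𝓝 (1 / 2)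
  | negInf => atBot ×ˢ 𝓝 (1 / 2)

/-- The action of the deck transformation with index `j` on the ends. -/
def shift (n m : ℕ) (j : ℤ) : Vertex → Vertex
  | lower k => lower (k + j * n)
  | upper k => upper (k + j * m)
  | posInf => posInf
  | negInf => negInf

end Vertex

/-- `v` and `w` are consecutive marked points on the same boundary component of the strip, that
is, the ends of a (lifted) boundary segment. -/
def BoundarySegment (m : ℕ) : Vertex → Vertex → Prop
  | Vertex.lower k, Vertex.lower l => l = k + 1 ∨ k = l + 1
  | Vertex.upper k, Vertex.upper l => m ≠ 0 ∧ (l = k + 1 ∨ k = l + 1)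
  | _, _ => False

/-! ## Curves and arcs -/

/-- A curve in the annulus that represents an arc, given by a lift to the strip. The curve
without its ends is parametrized by `ℝ` and runs in the interior of the strip, from `src` to
`tgt`; its image in the annulus has no self-intersections (the two ends may coincide there).

It joins two marked points (a finite arc), or a marked point with `±∞` (an asymptotic arc: a
Prüfer or an adic arc). It is not contractible, so its lift is not closed, and it does not join
two consecutive marked points of the same boundary component of the strip, so it is not
homotopic to a boundary segment. -/
structure Curve (n m : ℕ) where
  src : Vertex
  tgt : Vertex
  toFun : ℝ → ℝ × ℝ
  continuous_toFun : Continuous toFun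
  mem_openStrip : ∀ t, toFun t ∈ openStrip
  tendsto_src : Tendsto toFun atBot (src.toFilter n m)
  tendsto_tgt : Tendsto toFun atTop (tgt.toFilter n m)
  ends : (src.IsMarked m ∧ tgt.IsMarked m) ∨ (src.IsMarked m ∧ tgt.IsInfinite) ∨
    (src.IsInfinite ∧ tgt.IsMarked m)
  not_closed : src ≠ tgt
  not_boundary : ¬ BoundarySegment m src tgt
  simple : Function.Injective (fun t => cover n m (toFun t))

/-- `γ` and `δ`, curves in the strip that run from `v` to `w`, are homotopic through such curves,
with fixed ends (the convergence to the ends is uniform in the homotopy parameter). For curves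
without self-intersections on a surface this is the same as isotopy with fixed ends. -/
def HomotopicRel (n m : ℕ) (v w : Vertex) (γ δ : ℝ → ℝ × ℝ) : Prop :=
  ∃ H : unitInterval × ℝ → ℝ × ℝ, Continuous H ∧ (∀ p, H p ∈ openStrip) ∧
    (∀ t, H (0, t) = γ t) ∧ (∀ t, H (1, t) = δ t) ∧
    Tendsto H (⊤ ×ˢ atBot) (v.toFilter n m) ∧ Tendsto H (⊤ ×ˢ atTop) (w.toFilter n m)

/-- Two curves represent the same (unoriented) arc of the annulus: up to a deck transformation and
up to reversal of one of them their lifts are homotopic with fixed ends. -/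
def Curve.Equivalent {n m : ℕ} (c d : Curve n m) : Prop :=
  ∃ j : ℤ,
    (c.src = d.src.shift n m j ∧ c.tgt = d.tgt.shift n m j ∧
      HomotopicRel n m c.src c.tgt c.toFun (fun t => deck n m j (d.toFun t))) ∨
    (c.src = d.tgt.shift n m j ∧ c.tgt = d.src.shift n m j ∧
      HomotopicRel n m c.src c.tgt c.toFun (fun t => deck n m j (d.toFun (-t))))

/-! ### `Curve.Equivalent` is an equivalence relation -/

theorem tendsto_of_mem_uIcc {α : Type*} {a : Filter α} {l : Filter ℝ}
    [TendstoIxxClass Set.Icc l l] {f g h : α → ℝ} (hf : Tendsto f a l) (hg : Tendsto g a l)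
    (hh : ∀ x, h x ∈ Set.uIcc (f x) (g x)) : Tendsto h a l := by
  intro s hs
  have hfg := tendsto_smallSets_iff.1 (hf.uIcc hg) s hs
  exact hfg.mono fun x hx => hx (hh x)

theorem tendsto_segment {α : Type*} {n m : ℕ} {a : Filter α} (v : Vertex) {f g h : α → ℝ × ℝ}
    (hf : Tendsto f a (v.toFilter n m)) (hg : Tendsto g a (v.toFilter n m))
    (h1 : ∀ x, (h x).1 ∈ Set.uIcc (f x).1 (g x).1)
    (h2 : ∀ x, (h x).2 ∈ Set.uIcc (f x).2 (g x).2) : Tendsto h a (v.toFilter n m) := by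
  cases v <;> simp only [Vertex.toFilter, nhds_prod_eq, tendsto_prod_iff'] at hf hg ⊢ <;>
    exact ⟨tendsto_of_mem_uIcc hf.1 hg.1 h1, tendsto_of_mem_uIcc hf.2 hg.2 h2⟩

theorem mem_uIcc_segment (s : unitInterval) (a b : ℝ) :
    (1 - (s : ℝ)) * a + s * b ∈ Set.uIcc a b := by
  rw [← segment_eq_uIcc]
  exact ⟨1 - s, s, sub_nonneg.2 s.2.2, s.2.1, by ring, by simp⟩

/-- The strip is convex: any two curves with the same ends are homotopic. -/
theorem homotopicRel_of_ends {n m : ℕ} {v w : Vertex} {γ δ : ℝ → ℝ × ℝ}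
    (hγ : Continuous γ) (hδ : Continuous δ)
    (hγs : ∀ t, γ t ∈ openStrip) (hδs : ∀ t, δ t ∈ openStrip)
    (hγv : Tendsto γ atBot (v.toFilter n m)) (hδv : Tendsto δ atBot (v.toFilter n m))
    (hγw : Tendsto γ atTop (w.toFilter n m)) (hδw : Tendsto δ atTop (w.toFilter n m)) :
    HomotopicRel n m v w γ δ := by
  refine ⟨fun p => ((1 - (p.1 : ℝ)) * (γ p.2).1 + p.1 * (δ p.2).1,
    (1 - (p.1 : ℝ)) * (γ p.2).2 + p.1 * (δ p.2).2), by fun_prop, ?_, by simp, by simp, ?_, ?_⟩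
  · intro p
    have h := mem_uIcc_segment p.1 (γ p.2).2 (δ p.2).2
    have h' : Set.uIcc (γ p.2).2 (δ p.2).2 ⊆ Set.Ioo (0 : ℝ) 1 :=
      Set.OrdConnected.uIcc_subset Set.ordConnected_Ioo (hγs p.2) (hδs p.2)
    exact h' h
  · exact tendsto_segment v (hγv.comp tendsto_snd) (hδv.comp tendsto_snd)
      (fun p => mem_uIcc_segment _ _ _) (fun p => mem_uIcc_segment _ _ _)
  · exact tendsto_segment w (hγw.comp tendsto_snd) (hδw.comp tendsto_snd)
      (fun p => mem_uIcc_segment _ _ _) (fun p => mem_uIcc_segment _ _ _)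

theorem continuous_deck (n m : ℕ) (j : ℤ) : Continuous (deck n m j) := by
  unfold deck; fun_prop

theorem tendsto_deck (n m : ℕ) (j : ℤ) {v : Vertex} (hv : v.IsMarked m ∨ v.IsInfinite) :
    Tendsto (deck n m j) (v.toFilter n m) ((v.shift n m j).toFilter n m) := by
  cases v with
  | lower k =>
    refine (continuous_deck n m j).tendsto' _ _ ?_
    by_cases h : m = 0 <;> simp [deck, period, h]
    ring
  | upper k =>
    have h : m ≠ 0 := by simpa [Vertex.IsMarked, Vertex.IsInfinite] using hv
    refine (continuous_deck n m j).tendsto' _ _ ?_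
    simp [deck, period, h]
    ring
  | posInf =>
    exact (tendsto_atTop_add_const_right _ _ tendsto_fst).prodMk tendsto_snd
  | negInf =>
    exact (tendsto_atBot_add_const_right _ _ tendsto_fst).prodMk tendsto_snd

theorem Vertex.shift_shift (n m : ℕ) (i j : ℤ) (v : Vertex) :
    (v.shift n m i).shift n m j = v.shift n m (i + j) := by
  cases v <;> simp [Vertex.shift] <;> ring

theorem Vertex.shift_zero (n m : ℕ) (v : Vertex) : v.shift n m 0 = v := by
  cases v <;> simp [Vertex.shift]

theorem Vertex.eq_shift_iff (n m : ℕ) (j : ℤ) (v w : Vertex) :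
    v = w.shift n m j ↔ w = v.shift n m (-j) := by
  constructor <;> rintro rfl <;> simp [Vertex.shift_shift, Vertex.shift_zero]

theorem Curve.src_valid {n m : ℕ} (c : Curve n m) : c.src.IsMarked m ∨ c.src.IsInfinite := by
  rcases c.ends with h | h | h <;> simp [h]

theorem Curve.tgt_valid {n m : ℕ} (c : Curve n m) : c.tgt.IsMarked m ∨ c.tgt.IsInfinite := by
  rcases c.ends with h | h | h <;> simp [h]

/-- Curves represent the same arc if and only if their ends agree up to a deck transformation and
up to reversal. -/
theorem Curve.equivalent_iff {n m : ℕ} (c d : Curve n m) :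
    c.Equivalent d ↔ ∃ j : ℤ, (c.src = d.src.shift n m j ∧ c.tgt = d.tgt.shift n m j) ∨
      (c.src = d.tgt.shift n m j ∧ c.tgt = d.src.shift n m j) := by
  refine exists_congr fun j => or_congr ?_ ?_
  · refine ⟨fun h => ⟨h.1, h.2.1⟩, fun h => ⟨h.1, h.2, ?_⟩⟩
    refine homotopicRel_of_ends c.continuous_toFun
      ((continuous_deck n m j).comp d.continuous_toFun) c.mem_openStrip
      (fun t => d.mem_openStrip t) c.tendsto_src ?_ c.tendsto_tgt ?_
    · rw [h.1]; exact (tendsto_deck n m j d.src_valid).comp d.tendsto_src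
    · rw [h.2]; exact (tendsto_deck n m j d.tgt_valid).comp d.tendsto_tgt
  · refine ⟨fun h => ⟨h.1, h.2.1⟩, fun h => ⟨h.1, h.2, ?_⟩⟩
    refine homotopicRel_of_ends c.continuous_toFun
      ((continuous_deck n m j).comp (d.continuous_toFun.comp continuous_neg)) c.mem_openStrip
      (fun t => d.mem_openStrip (-t)) c.tendsto_src ?_ c.tendsto_tgt ?_
    · rw [h.1]
      exact (tendsto_deck n m j d.tgt_valid).comp (d.tendsto_tgt.comp tendsto_neg_atBot_atTop)
    · rw [h.2]
      exact (tendsto_deck n m j d.src_valid).comp (d.tendsto_src.comp tendsto_neg_atTop_atBot)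

theorem Curve.equivalence (n m : ℕ) : Equivalence (Curve.Equivalent (n := n) (m := m)) where
  refl c := (c.equivalent_iff c).2 ⟨0, by simp [Vertex.shift_zero]⟩
  symm := by
    intro c d h
    rw [Curve.equivalent_iff] at h ⊢
    obtain ⟨j, h⟩ := h
    refine ⟨-j, ?_⟩
    rcases h with ⟨h1, h2⟩ | ⟨h1, h2⟩ <;> rw [Vertex.eq_shift_iff] at h1 h2
    · exact Or.inl ⟨h1, h2⟩
    · exact Or.inr ⟨h2, h1⟩
  trans := by
    intro c d e h h'
    rw [Curve.equivalent_iff] at h h' ⊢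
    obtain ⟨j, h⟩ := h
    obtain ⟨k, h'⟩ := h'
    refine ⟨k + j, ?_⟩
    rcases h with ⟨h1, h2⟩ | ⟨h1, h2⟩ <;> rcases h' with ⟨h3, h4⟩ | ⟨h3, h4⟩ <;>
      simp [h1, h2, h3, h4, Vertex.shift_shift]

instance curveSetoid (n m : ℕ) : Setoid (Curve n m) := ⟨Curve.Equivalent, Curve.equivalence n m⟩

/-! ## Triangulations and their quiddity sequences -/

/-- The arcs of the annulus `A_{n,m}`, finite and asymptotic ones: classes of curves. -/
def Arc (n m : ℕ) : Type := Quotient (curveSetoid n m)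

/-- The arc represented by a curve. -/
def Curve.toArc {n m : ℕ} (c : Curve n m) : Arc n m := Quotient.mk (curveSetoid n m) c

/-- Two arcs are compatible if they have representatives that do not intersect in the annulus
(except possibly at their ends). -/
def Compatible {n m : ℕ} (A B : Arc n m) : Prop :=
  ∃ c d : Curve n m, c.toArc = A ∧ d.toArc = B ∧
    ∀ s t, cover n m (c.toFun s) ≠ cover n m (d.toFun t)

/-- A triangulation is a maximal collection of pairwise compatible arcs. -/
def IsTriangulation {n m : ℕ} (T : Set (Arc n m)) : Prop :=
  Maximal (fun S : Set (Arc n m) => S.Pairwise Compatible) T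

/-- `v` and `w` are joined by a boundary segment of the strip or by an arc of the preimage of `T`
in the strip. -/
def Joined {n m : ℕ} (T : Set (Arc n m)) (v w : Vertex) : Prop :=
  BoundarySegment m v w ∨ ∃ c : Curve n m, c.toArc ∈ T ∧ c.src = v ∧ c.tgt = w

/-- The triangles of the preimage of `T` in the strip that are incident with `v`. The sides of a
triangle are boundary segments or arcs of the preimage of `T`, and since the strip is simply
connected, a triangle is given by the set of its three vertices. One of them can be `±∞`. -/
def trianglesAt {n m : ℕ} (T : Set (Arc n m)) (v : Vertex) : Set (Finset Vertex) :=
  {t | t.card = 3 ∧ v ∈ t ∧ (t : Set Vertex).Pairwise (Joined T)}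

/-- The outer quiddity sequence `(a_1, …, a_n)` of `T`: the entry `a_i` is the number of triangles
incident with the `i`-th outer marked point, in the universal cover. -/
def quiddity {n m : ℕ} (T : Set (Arc n m)) (i : Fin n) : ℕ :=
  (trianglesAt T (Vertex.lower (i : ℕ))).ncard

end AnnulusFrieze

end

/-! A sequence `a` is the quiddity sequence of an infinite frieze as soon as the equation `x (p + 1)
= a p * x p - x (p - 1)` has a positive supersolution, that is, a positive `w` with `w (p - 1) + w
(p + 1) ≤ a p * w p`. The rows of the frieze are the solutions with initial values `0, 1`, the
unimodular rule is the constancy of a Casoratian, and Sturm comparison with `w` gives positivity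
(`exists_isInfiniteFrieze`).

Such a `w` can be read off from the peripheral arcs at the outer boundary. In the strip, a lower
vertex has weight `1` if no arc between lower vertices passes over it; otherwise it is the middle
vertex of a unique triangle with lower vertices, and its weight is the sum of the two other weights.
Let `(l, p)` and `(p, r)` be the longest peripheral arcs (or segments) on the two sides of `p`. The
triangles at `p` below them express `w (p - 1)` as `w l` and `w (p + 1)` as `w r`, plus one copy of
`w p` per triangle. If an arc passes over `p`, then `(l, p, r)` is a triangle and `w l + w r = w p`.
Otherwise all three weights are `1`, so `w l + w r = 2 * w p`, and two further triangles stand on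
`(l, p)` and `(p, r)`, with third vertices on the upper boundary or at an end of the strip. Either
way enough triangles at `p` are exhibited (`weight_add_weight_le`); that there are no others is not
needed.

Topology enters through two facts. The strip is identified with the upper half plane and the
vertices with boundary points, so that separation of pairs becomes the sign of a product of
determinants. Lifts whose ends separate each other meet, by Poincaré–Miranda, so edges do not cross
(`Edge.crossing_nonneg`). Conversely, hyperbolic geodesics whose ends do not separate each other are
disjoint or equal, and deck transformations permute geodesics. Hence geodesics represent all arcs at
once, and by maximality an admissible pair of vertices that crosses neither its translates nor an
edge is itself an edge (`edge_of_crossing_nonneg`). The rest is combinatorics of indices. -/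

noncomputable section

namespace AnnulusFrieze

/-! ## Crossing curves -/

/-- A continuous real function on an interval that starts in `(a, b)` and avoids `a` and `b` stays
in `(a, b)`. -/
theorem mem_Ioo_of_forall_ne {f : ℝ → ℝ} (hf : Continuous f) {a b : ℝ} {s t : ℝ}
    (h0 : f s ∈ Set.Ioo a b) (ha : ∀ r ∈ Set.uIcc s t, f r ≠ a) (hb : ∀ r ∈ Set.uIcc s t, f r ≠ b) :
    f t ∈ Set.Ioo a b := by
  have hI := intermediate_value_uIcc (a := s) (b := t) hf.continuousOn
  refine ⟨?_, ?_⟩ <;> by_contra! h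
  · obtain ⟨r, hr, h'⟩ := hI (Set.mem_uIcc.2 (Or.inr ⟨h, h0.1.le⟩))
    exact ha r hr h'
  · obtain ⟨r, hr, h'⟩ := hI (Set.mem_uIcc.2 (Or.inl ⟨h0.2.le, h⟩))
    exact hb r hr h'

/-- The two-dimensional Poincaré–Miranda theorem. -/
theorem exists_zero_of_sign_change {f : ℝ × ℝ → ℂ} (hf : Continuous f) {a b c d : ℝ}
    (hab : a ≤ b) (hcd : c ≤ d)
    (hl : ∀ t ∈ Set.Icc c d, (f (a, t)).re < 0) (hr : ∀ t ∈ Set.Icc c d, 0 < (f (b, t)).re)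
    (hd : ∀ s ∈ Set.Icc a b, 0 < (f (s, c)).im) (hu : ∀ s ∈ Set.Icc a b, (f (s, d)).im < 0) :
    ∃ s ∈ Set.Icc a b, ∃ t ∈ Set.Icc c d, f (s, t) = 0 := by
  by_contra! hne
  -- Clamping to the rectangle gives a nowhere vanishing map on the simply connected plane, which
  -- lifts through `exp` and so has a continuous argument `θ`. The signs on the four sides force `θ`
  -- to gain a full turn around the boundary, although it is single-valued.
  let F : C(ℝ × ℝ, ℂ) := ⟨fun p => f (Set.projIcc a b hab p.1, Set.projIcc c d hcd p.2), by
    fun_prop⟩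
  have hF : ∀ p, F p ≠ 0 := fun p => hne _ (Set.projIcc a b hab p.1).2 _ (Set.projIcc c d hcd p.2).2
  have hFf : ∀ s ∈ Set.Icc a b, ∀ t ∈ Set.Icc c d, F (s, t) = f (s, t) := by
    intro s hs t ht
    simp [F, Set.projIcc_of_mem hab hs, Set.projIcc_of_mem hcd ht]
  obtain ⟨G, ⟨hG0, hG⟩, -⟩ := Complex.isCoveringMapOn_exp.existsUnique_continuousMap_lifts F
    (a₀ := (a, c)) (e₀ := Complex.log (F (a, c))) (Complex.exp_log (hF _)) hF
  have hG' : ∀ p, F p = Complex.exp (G p) := fun p => (congrFun hG p).symm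
  let θ : ℝ × ℝ → ℝ := fun p => (G p).im
  have hθ : Continuous θ := by fun_prop
  have hre : ∀ p, (F p).re = Real.exp (G p).re * Real.cos (θ p) := fun p => by
    rw [hG', Complex.exp_re]
  have him : ∀ p, (F p).im = Real.exp (G p).re * Real.sin (θ p) := fun p => by
    rw [hG', Complex.exp_im]
  have ha : a ∈ Set.Icc a b := ⟨le_rfl, hab⟩
  have hb : b ∈ Set.Icc a b := ⟨hab, le_rfl⟩
  have hc : c ∈ Set.Icc c d := ⟨le_rfl, hcd⟩
  have hd' : d ∈ Set.Icc c d := ⟨hcd, le_rfl⟩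
  have L : ∀ t ∈ Set.Icc c d, Real.cos (θ (a, t)) < 0 := fun t ht => by
    have := hl t ht
    rw [← hFf a ha t ht, hre] at this
    exact neg_of_mul_neg_right this (Real.exp_pos _).le
  have R : ∀ t ∈ Set.Icc c d, 0 < Real.cos (θ (b, t)) := fun t ht => by
    have := hr t ht
    rw [← hFf b hb t ht, hre] at this
    exact pos_of_mul_pos_right this (Real.exp_pos _).le
  have D : ∀ s ∈ Set.Icc a b, 0 < Real.sin (θ (s, c)) := fun t ht => by
    have := hd t ht
    rw [← hFf t ht c hc, him] at this
    exact pos_of_mul_pos_right this (Real.exp_pos _).le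
  have U : ∀ s ∈ Set.Icc a b, Real.sin (θ (s, d)) < 0 := fun t ht => by
    have := hu t ht
    rw [← hFf t ht d hd', him] at this
    exact neg_of_mul_neg_right this (Real.exp_pos _).le
  have hπ := Real.pi_pos
  have cos_zero : ∀ k : ℤ, Real.cos (Real.pi / 2 + k * Real.pi) = 0 := fun k => by
    rw [Real.cos_eq_zero_iff]; exact ⟨k, by ring⟩
  -- The principal logarithm at the corner `(a, c)` normalizes `θ` there to the second quadrant,
  -- between `π / 2` and `π`.
  have h00 : θ (a, c) ∈ Set.Ioo (Real.pi / 2) (Real.pi / 2 + (1 : ℤ) * Real.pi) := by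
    have h1 : θ (a, c) ∈ Set.Ioc (-Real.pi) Real.pi := by
      simp only [θ, hG0]; exact ⟨Complex.neg_pi_lt_log_im _, Complex.log_im_le_pi _⟩
    have h2 := L c hc
    have h3 := D a ha
    refine ⟨?_, ?_⟩
    · by_contra! h
      by_cases h' : θ (a, c) ≤ 0
      · exact h3.not_ge (Real.sin_nonpos_of_nonpos_of_neg_pi_le h' h1.1.le)
      · exact h2.not_ge (Real.cos_nonneg_of_mem_Icc ⟨by linarith, h⟩)
    · have := h1.2
      push_cast; linarith
  have hac : θ (a, c) < Real.pi := by
    by_contra! h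
    refine (D a ha).not_ge ?_
    rw [← Real.sin_sub_two_pi]
    refine Real.sin_nonpos_of_nonpos_of_neg_pi_le ?_ (by linarith)
    have := h00.2; push_cast at this; linarith
  -- the left side
  have h01 : θ (a, d) ∈ Set.Ioo (Real.pi / 2) (Real.pi / 2 + (1 : ℤ) * Real.pi) := by
    refine mem_Ioo_of_forall_ne (f := fun t => θ (a, t)) (by fun_prop) h00 ?_ ?_ <;>
      rw [Set.uIcc_of_le hcd] <;> intro r hr h <;> refine (L r hr).ne ?_
    · have := cos_zero 0
      rw [h]; simp
    · rw [h]; exact cos_zero 1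
  have h01' : θ (a, d) ∈ Set.Ioo ((1 : ℤ) * Real.pi) ((2 : ℤ) * Real.pi) := by
    refine ⟨?_, by have := h01.2; push_cast at *; linarith⟩
    by_contra! h
    refine (U a ha).not_ge (Real.sin_nonneg_of_nonneg_of_le_pi (by linarith [h01.1]) ?_)
    push_cast at h; linarith
  -- the upper side
  have h11 : θ (b, d) ∈ Set.Ioo ((1 : ℤ) * Real.pi) ((2 : ℤ) * Real.pi) := by
    refine mem_Ioo_of_forall_ne (f := fun s => θ (s, d)) (by fun_prop) h01' ?_ ?_ <;>
      rw [Set.uIcc_of_le hab] <;> intro r hr h <;> refine (U r hr).ne ?_ <;> rw [h] <;>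
      exact Real.sin_int_mul_pi _
  have h11' : θ (b, d) ∈ Set.Ioo (Real.pi / 2 + (1 : ℤ) * Real.pi)
      (Real.pi / 2 + (2 : ℤ) * Real.pi) := by
    refine ⟨?_, by have := h11.2; push_cast at *; linarith⟩
    by_contra! h
    refine (R d hd').not_ge (Real.cos_nonpos_of_pi_div_two_le_of_le ?_ ?_)
    · have := h11.1; push_cast at this; linarith
    · push_cast at h; linarith
  -- the right side
  have h10 : θ (b, c) ∈ Set.Ioo (Real.pi / 2 + (1 : ℤ) * Real.pi)
      (Real.pi / 2 + (2 : ℤ) * Real.pi) := by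
    refine mem_Ioo_of_forall_ne (f := fun t => θ (b, t)) (by fun_prop) h11' ?_ ?_ <;>
      rw [Set.uIcc_of_ge hcd] <;> intro r hr h <;> refine (R r hr).ne' ?_ <;> rw [h] <;>
      exact cos_zero _
  have h10' : θ (b, c) ∈ Set.Ioo ((2 : ℤ) * Real.pi) ((3 : ℤ) * Real.pi) := by
    refine ⟨?_, by have := h10.2; push_cast at *; linarith⟩
    by_contra! h
    refine (D b hb).not_ge ?_
    rw [← Real.sin_sub_two_pi]
    push_cast at h
    refine Real.sin_nonpos_of_nonpos_of_neg_pi_le (by linarith) ?_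
    have := h10.1; push_cast at this; linarith
  -- the lower side
  have h00' : θ (a, c) ∈ Set.Ioo ((2 : ℤ) * Real.pi) ((3 : ℤ) * Real.pi) := by
    refine mem_Ioo_of_forall_ne (f := fun s => θ (s, c)) (by fun_prop) h10' ?_ ?_ <;>
      rw [Set.uIcc_of_ge hab] <;> intro r hr h <;> refine (D r hr).ne' ?_ <;> rw [h] <;>
      exact Real.sin_int_mul_pi _
  have := h00'.1
  push_cast at this
  linarith

/-- A point `z` of the upper half plane is determined by `‖z‖` and `re z / ‖z‖`. -/
theorem eq_of_norm_eq_of_re_div_norm_eq {z w : ℂ} (hz : 0 < z.im) (hw : 0 < w.im)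
    (h : ‖z‖ = ‖w‖) (h' : z.re / ‖z‖ = w.re / ‖w‖) : z = w := by
  have hw0 : ‖w‖ ≠ 0 := by
    rw [norm_ne_zero_iff]; rintro rfl; simp at hw
  rw [h, div_left_inj' hw0] at h'
  have h2 : Complex.normSq z = Complex.normSq w := by
    rw [Complex.normSq_eq_norm_sq, Complex.normSq_eq_norm_sq, h]
  rw [Complex.normSq_apply, Complex.normSq_apply, h'] at h2
  refine Complex.ext h' ?_
  have : z.im ^ 2 = w.im ^ 2 := by linarith
  exact (sq_eq_sq₀ hz.le hw.le).1 this

theorem abs_re_div_norm_lt_one {z : ℂ} (hz : 0 < z.im) : |z.re / ‖z‖| < 1 := by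
  have hz0 : 0 < ‖z‖ := norm_pos_iff.2 (by rintro rfl; simp at hz)
  rw [abs_div, abs_norm, div_lt_one hz0]
  exact Complex.abs_re_lt_norm.2 hz.ne'

/-- In the upper half plane, a curve from `0` to `∞` meets every curve from the positive to the
negative real axis. -/
theorem exists_eq_of_upperHalfPlane {γ δ : ℝ → ℂ} (hγ : Continuous γ) (hδ : Continuous δ)
    (hγi : ∀ t, 0 < (γ t).im) (hδi : ∀ t, 0 < (δ t).im)
    (h0 : Tendsto γ atBot (𝓝 0)) (h1 : Tendsto (fun t => ‖γ t‖) atTop atTop)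
    {b d : ℝ} (hb : 0 < b) (hd : d < 0)
    (hδb : Tendsto δ atBot (𝓝 b)) (hδd : Tendsto δ atTop (𝓝 d)) : ∃ s t, γ s = δ t := by
  have nγ : ∀ t, ‖γ t‖ ≠ 0 := fun t => norm_ne_zero_iff.2 fun h => by simpa [h] using hγi t
  have nδ : ∀ t, ‖δ t‖ ≠ 0 := fun t => norm_ne_zero_iff.2 fun h => by simpa [h] using hδi t
  -- the absolute value of `δ` is bounded above and away from `0`
  have hbound : ∃ r R : ℝ, 0 < r ∧ ∀ t, r ≤ ‖δ t‖ ∧ ‖δ t‖ ≤ R := by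
    have e1 : ∀ᶠ t in atBot, ‖δ t‖ ∈ Set.Ioo (b / 2) (2 * b) := by
      have : Tendsto (fun t => ‖δ t‖) atBot (𝓝 b) := by
        have := hδb.norm
        rwa [Complex.norm_real, Real.norm_of_nonneg hb.le] at this
      exact this.eventually (Ioo_mem_nhds (by linarith) (by linarith))
    have e2 : ∀ᶠ t in atTop, ‖δ t‖ ∈ Set.Ioo (-d / 2) (2 * -d) := by
      have : Tendsto (fun t => ‖δ t‖) atTop (𝓝 (-d)) := by
        have := hδd.norm
        rwa [Complex.norm_real, Real.norm_of_nonpos hd.le] at this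
      exact this.eventually (Ioo_mem_nhds (by linarith) (by linarith))
    obtain ⟨x, hx⟩ := eventually_atBot.1 e1
    obtain ⟨y, hy⟩ := eventually_atTop.1 e2
    obtain ⟨p, -, hp⟩ := isCompact_uIcc.exists_isMinOn (s := Set.uIcc x y) ⟨x, Set.left_mem_uIcc⟩
      (f := fun t => ‖δ t‖) (by fun_prop)
    obtain ⟨q, -, hq⟩ := isCompact_uIcc.exists_isMaxOn (s := Set.uIcc x y) ⟨x, Set.left_mem_uIcc⟩
      (f := fun t => ‖δ t‖) (by fun_prop)
    refine ⟨min ‖δ p‖ (min (b / 2) (-d / 2)), max ‖δ q‖ (max (2 * b) (2 * -d)), ?_, ?_⟩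
    · refine lt_min ((norm_nonneg _).lt_of_ne (nδ p).symm) (lt_min ?_ ?_) <;> linarith
    · intro t
      simp only [min_le_iff, le_max_iff]
      rcases le_total t x with h | h
      · have := hx t h
        exact ⟨Or.inr (Or.inl this.1.le), Or.inr (Or.inl this.2.le)⟩
      rcases le_total y t with h' | h'
      · have := hy t h'
        exact ⟨Or.inr (Or.inr this.1.le), Or.inr (Or.inr this.2.le)⟩
      · have ht : t ∈ Set.uIcc x y := Set.mem_uIcc.2 (Or.inl ⟨h, h'⟩)
        exact ⟨Or.inl (hp ht), Or.inl (hq ht)⟩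
  obtain ⟨r, R, hr, hrR⟩ := hbound
  obtain ⟨s₀, hs₀⟩ := eventually_atBot.1
    ((by simpa using h0.norm : Tendsto (fun t => ‖γ t‖) atBot (𝓝 0)).eventually (gt_mem_nhds hr))
  obtain ⟨s₁, hs₁⟩ := eventually_atTop.1 (h1.eventually_gt_atTop R)
  set a := min s₀ s₁
  have hab : a ≤ s₁ := min_le_right _ _
  have ha : ‖γ a‖ < r := hs₀ a (min_le_left _ _)
  have hb' : R < ‖γ s₁‖ := hs₁ s₁ le_rfl
  -- the argument of `γ` on the compact interval
  have cγ : Continuous fun t => (γ t).re / ‖γ t‖ :=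
    Continuous.div (by fun_prop) (by fun_prop) nγ
  have cδ : Continuous fun t => (δ t).re / ‖δ t‖ :=
    Continuous.div (by fun_prop) (by fun_prop) nδ
  have ne : (Set.Icc a s₁).Nonempty := ⟨a, le_rfl, hab⟩
  obtain ⟨p, -, hp⟩ := isCompact_Icc.exists_isMinOn ne cγ.continuousOn
  obtain ⟨q, -, hq⟩ := isCompact_Icc.exists_isMaxOn ne cγ.continuousOn
  have tb : Tendsto (fun t => (δ t).re / ‖δ t‖) atBot (𝓝 1) := by
    have hb0 : (b : ℂ) ≠ 0 := by exact_mod_cast hb.ne'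
    have := ((Complex.continuous_re.tendsto _).comp hδb).div hδb.norm (norm_ne_zero_iff.2 hb0)
    simpa [abs_of_pos hb, hb.ne', Pi.div_def] using this
  have td : Tendsto (fun t => (δ t).re / ‖δ t‖) atTop (𝓝 (-1)) := by
    have hd0 : (d : ℂ) ≠ 0 := by exact_mod_cast hd.ne
    have := ((Complex.continuous_re.tendsto _).comp hδd).div hδd.norm (norm_ne_zero_iff.2 hd0)
    simpa [abs_of_neg hd, hd.ne, div_neg, Pi.div_def] using this
  obtain ⟨t₀, ht₀⟩ := eventually_atBot.1
    (tb.eventually (lt_mem_nhds (abs_lt.1 (abs_re_div_norm_lt_one (hγi q))).2))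
  obtain ⟨t₁, ht₁⟩ := eventually_atTop.1
    (td.eventually (gt_mem_nhds (abs_lt.1 (abs_re_div_norm_lt_one (hγi p))).1))
  set c := min t₀ t₁
  have hcd : c ≤ t₁ := min_le_right _ _
  -- Poincaré–Miranda in polar coordinates: the real part compares absolute values, the imaginary
  -- part cosines of arguments. The interval for `s` is fixed first, from bounds valid on all of
  -- `δ`; the interval for `t` depends on the extreme arguments of `γ` over it.
  obtain ⟨s, -, t, -, h⟩ := exists_zero_of_sign_change
    (f := fun x => ⟨‖γ x.1‖ - ‖δ x.2‖, (δ x.2).re / ‖δ x.2‖ - (γ x.1).re / ‖γ x.1‖⟩)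
    (a := a) (b := s₁) (c := c) (d := t₁)
    (by
      rw [show (fun x : ℝ × ℝ => (⟨‖γ x.1‖ - ‖δ x.2‖,
          (δ x.2).re / ‖δ x.2‖ - (γ x.1).re / ‖γ x.1‖⟩ : ℂ)) = fun x : ℝ × ℝ =>
          Complex.equivRealProdCLM.symm (‖γ x.1‖ - ‖δ x.2‖,
            (δ x.2).re / ‖δ x.2‖ - (γ x.1).re / ‖γ x.1‖) from rfl]
      exact Complex.equivRealProdCLM.symm.continuous.comp (Continuous.prodMk (by fun_prop)
        ((cδ.comp continuous_snd).sub (cγ.comp continuous_fst))))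
    hab hcd
    (fun t _ => sub_neg.2 (ha.trans_le (hrR t).1)) (fun t _ => sub_pos.2 ((hrR t).2.trans_lt hb'))
    (fun s hs => sub_pos.2 (lt_of_le_of_lt (hq hs) (ht₀ c (min_le_left _ _))))
    (fun s hs => sub_neg.2 (lt_of_lt_of_le (ht₁ t₁ le_rfl) (hp hs)))
  have h' := Complex.ext_iff.1 h
  exact ⟨s, t, eq_of_norm_eq_of_re_div_norm_eq (hγi s) (hδi t) (sub_eq_zero.1 h'.1)
    (sub_eq_zero.1 h'.2).symm⟩

/-- `exists_eq_of_upperHalfPlane` for curves in either half plane and with either orientation. -/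
theorem exists_eq_of_im_pos_of_mul_neg {γ δ : ℝ → ℂ} (hγ : Continuous γ) (hδ : Continuous δ)
    {σ : ℝ} (hγi : ∀ t, 0 < σ * (γ t).im) (hδi : ∀ t, 0 < σ * (δ t).im)
    (h0 : Tendsto γ atBot (𝓝 0)) (h1 : Tendsto (fun t => ‖γ t‖) atTop atTop)
    {b d : ℝ} (hbd : b * d < 0)
    (hδb : Tendsto δ atBot (𝓝 b)) (hδd : Tendsto δ atTop (𝓝 d)) : ∃ s t, γ s = δ t := by
  wlog hb : 0 < b generalizing δ b d
  · obtain ⟨s, t, h⟩ := this (δ := fun t => δ (-t)) (by fun_prop) (fun t => hδi _) (b := d) (d := b)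
      (by rwa [mul_comm]) (hδd.comp tendsto_neg_atBot_atTop) (hδb.comp tendsto_neg_atTop_atBot) (by
        by_contra! h
        exact hbd.not_ge (mul_nonneg_of_nonpos_of_nonpos (not_lt.1 hb) h))
    exact ⟨s, -t, h⟩
  have hd : d < 0 := neg_of_mul_neg_right hbd hb.le
  rcases lt_trichotomy σ 0 with hσ | rfl | hσ
  · obtain ⟨s, t, h⟩ := exists_eq_of_upperHalfPlane (γ := fun t => star (γ t))
      (δ := fun t => star (δ t)) (by fun_prop) (by fun_prop)
      (fun t => by
        have := neg_of_mul_pos_right (hγi t) hσ.le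
        simpa using this)
      (fun t => by
        have := neg_of_mul_pos_right (hδi t) hσ.le
        simpa using this)
      (by simpa [Function.comp_def] using (continuous_star.tendsto _).comp h0) (by simpa using h1) hb hd
      (by simpa [Function.comp_def] using (continuous_star.tendsto _).comp hδb)
      (by simpa [Function.comp_def] using (continuous_star.tendsto _).comp hδd)
    exact ⟨s, t, star_injective h⟩
  · simpa using hγi 0
  · exact exists_eq_of_upperHalfPlane hγ hδ (fun t => pos_of_mul_pos_right (hγi t) hσ.le)
      (fun t => pos_of_mul_pos_right (hδi t) hσ.le) h0 h1 hb hd hδb hδd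

/-! ## The strip and the upper half plane -/

/-- The strip as the upper half plane: the lower boundary becomes the positive, the upper boundary
the negative real axis, and the ends `∞` and `-∞` become `∞` and `0`. -/
def toHalfPlane (p : ℝ × ℝ) : ℂ := Complex.exp (Real.pi * (p.1 + p.2 * Complex.I))

/-- The inverse of `toHalfPlane`. -/
def ofHalfPlane (w : ℂ) : ℝ × ℝ := (Real.log ‖w‖ / Real.pi, w.arg / Real.pi)

theorem continuous_toHalfPlane : Continuous toHalfPlane := by
  unfold toHalfPlane; fun_prop

theorem toHalfPlane_eq (p : ℝ × ℝ) : toHalfPlane p =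
    Real.exp (Real.pi * p.1) * (Real.cos (Real.pi * p.2) + Real.sin (Real.pi * p.2) * Complex.I) := by
  rw [toHalfPlane, mul_add, Complex.exp_add, ← mul_assoc, Complex.exp_mul_I]
  push_cast
  ring_nf

theorem norm_toHalfPlane (p : ℝ × ℝ) : ‖toHalfPlane p‖ = Real.exp (Real.pi * p.1) := by
  rw [toHalfPlane, Complex.norm_exp]
  simp

theorem toHalfPlane_im_pos {p : ℝ × ℝ} (hp : p ∈ openStrip) : 0 < (toHalfPlane p).im := by
  have : (toHalfPlane p).im = Real.exp (Real.pi * p.1) * Real.sin (Real.pi * p.2) := by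
    rw [toHalfPlane, Complex.exp_im]; simp
  rw [this]
  have hπ := Real.pi_pos
  exact mul_pos (Real.exp_pos _) (Real.sin_pos_of_pos_of_lt_pi (mul_pos hπ hp.1)
    (mul_lt_of_lt_one_right hπ hp.2))

theorem toHalfPlane_ofHalfPlane {w : ℂ} (hw : w ≠ 0) : toHalfPlane (ofHalfPlane w) = w := by
  conv_rhs => rw [← Complex.exp_log hw]
  have hπ : (Real.pi : ℂ) ≠ 0 := by exact_mod_cast Real.pi_ne_zero
  rw [toHalfPlane, ofHalfPlane, Complex.log]
  push_cast
  congr 1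
  field_simp

theorem ofHalfPlane_toHalfPlane {p : ℝ × ℝ} (hp : p ∈ openStrip) :
    ofHalfPlane (toHalfPlane p) = p := by
  have hπ := Real.pi_pos
  have h : (toHalfPlane p).arg = Real.pi * p.2 := by
    rw [toHalfPlane_eq]
    push_cast
    rw [← Complex.ofReal_mul, ← Complex.ofReal_mul, ← Complex.ofReal_exp,
      Complex.arg_mul_cos_add_sin_mul_I (Real.exp_pos _)]
    have h0 := mul_pos hπ hp.1
    have h1 := mul_lt_of_lt_one_right hπ hp.2
    exact ⟨by linarith, h1.le⟩
  ext
  · simp only [ofHalfPlane, norm_toHalfPlane, Real.log_exp]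
    field_simp
  · simp only [ofHalfPlane, h]
    field_simp

theorem ofHalfPlane_mem_openStrip {w : ℂ} (hw : 0 < w.im) : ofHalfPlane w ∈ openStrip := by
  have hπ := Real.pi_pos
  have h0 : w.arg ≠ 0 := fun h => hw.ne' (Complex.arg_eq_zero_iff.1 h).2
  have h1 : w.arg ≠ Real.pi := fun h => hw.ne' (Complex.arg_eq_pi_iff.1 h).2
  exact ⟨div_pos ((Complex.arg_nonneg_iff.2 hw.le).lt_of_ne h0.symm) hπ,
    (div_lt_one hπ).2 ((Complex.arg_le_pi w).lt_of_ne h1)⟩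

/-- The branch cut of `arg` is the image of the upper boundary of the strip. One-sided continuity
from the closed half plane suffices there, since curves approach the cut only from above. -/
theorem continuousWithinAt_ofHalfPlane {w : ℂ} (hw : w ≠ 0) :
    ContinuousWithinAt ofHalfPlane {z | 0 ≤ z.im} w := by
  have h1 : ContinuousWithinAt Complex.arg {z | 0 ≤ z.im} w := by
    by_cases h : w ∈ Complex.slitPlane
    · exact (Complex.continuousAt_arg h).continuousWithinAt
    · have h' : w.re ≤ 0 ∧ w.im = 0 := by
        simpa [Complex.mem_slitPlane_iff, not_or] using h
      refine Complex.continuousWithinAt_arg_of_re_neg_of_im_zero (h'.1.lt_of_ne fun h0 => ?_) h'.2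
      exact hw (Complex.ext h0 h'.2)
  have h2 : ContinuousWithinAt (fun z : ℂ => Real.log ‖z‖) {z | 0 ≤ z.im} w :=
    (continuousWithinAt_id.norm).log (norm_ne_zero_iff.2 hw)
  exact (h2.div_const _).prodMk (h1.div_const _)

/-- Deck transformations become dilations of the half plane, which is why they permute its
geodesics. -/
theorem toHalfPlane_deck (n m : ℕ) (j : ℤ) (p : ℝ × ℝ) :
    toHalfPlane (deck n m j p) = Real.exp (Real.pi * (j * period n m)) * toHalfPlane p := by
  rw [toHalfPlane, toHalfPlane, deck, Complex.ofReal_exp, ← Complex.exp_add]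
  push_cast
  ring_nf

namespace Vertex

/-- Homogeneous coordinates of the point of the boundary of the upper half plane that corresponds
to a vertex. -/
def vec (n m : ℕ) : Vertex → ℝ × ℝ
  | lower k => (Real.exp (Real.pi * (k * (if m = 0 then 1 else (m : ℝ)))), 1)
  | upper k => (-Real.exp (Real.pi * (k * n)), 1)
  | posInf => (1, 0)
  | negInf => (0, 1)

end Vertex

/-- The determinant of the homogeneous coordinates of two vertices. -/
def bracket (n m : ℕ) (u v : Vertex) : ℝ :=
  (u.vec n m).1 * (v.vec n m).2 - (v.vec n m).1 * (u.vec n m).2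

/-- This is negative if and only if the pair `u`, `v` separates the pair `x`, `y` on the boundary
of the strip. -/
def crossing (n m : ℕ) (u v x y : Vertex) : ℝ :=
  bracket n m u x * bracket n m u y * (bracket n m v x * bracket n m v y)

section bracket

variable {n m : ℕ}

theorem bracket_swap (u v : Vertex) : bracket n m u v = -bracket n m v u := by
  unfold bracket; ring

theorem bracket_self (u : Vertex) : bracket n m u u = 0 := by
  unfold bracket; ring

theorem crossing_swap_left (u v x y : Vertex) : crossing n m v u x y = crossing n m u v x y := by
  unfold crossing; ring

theorem crossing_comm (u v x y : Vertex) : crossing n m x y u v = crossing n m u v x y := by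
  unfold crossing
  rw [bracket_swap u x, bracket_swap u y, bracket_swap v x, bracket_swap v y]
  ring

/-- The bracket is positive when its first argument is the larger in the order of the real line:
upper vertices by decreasing index, then `negInf`, lower vertices by increasing index, and `posInf`.
This and the next lemmas record the cases. -/
theorem bracket_lower_lower_pos {k l : ℤ} (h : l < k) :
    0 < bracket n m (.lower k) (.lower l) := by
  have hs : 0 < (if m = 0 then 1 else (m : ℝ)) := by
    split_ifs with h
    · exact one_pos
    · exact_mod_cast Nat.pos_of_ne_zero h
  have h' : (l : ℝ) < k := by exact_mod_cast h
  have := Real.exp_lt_exp.2 (mul_lt_mul_of_pos_left (mul_lt_mul_of_pos_right h' hs) Real.pi_pos)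
  simpa [bracket, Vertex.vec] using this

theorem bracket_upper_upper_pos (hn : 0 < n) {k l : ℤ} (h : k < l) :
    0 < bracket n m (.upper k) (.upper l) := by
  have hs : 0 < (n : ℝ) := by exact_mod_cast hn
  have h' : (k : ℝ) < l := by exact_mod_cast h
  have := Real.exp_lt_exp.2 (mul_lt_mul_of_pos_left (mul_lt_mul_of_pos_right h' hs) Real.pi_pos)
  simp only [bracket, Vertex.vec]
  linarith

theorem bracket_lower_upper_pos (k l : ℤ) : 0 < bracket n m (.lower k) (.upper l) := by
  simp only [bracket, Vertex.vec]
  linarith [Real.exp_pos (Real.pi * (k * (if m = 0 then 1 else (m : ℝ)))),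
    Real.exp_pos (Real.pi * (l * n))]

theorem bracket_lower_negInf_pos (k : ℤ) : 0 < bracket n m (.lower k) .negInf := by
  simp [bracket, Vertex.vec, Real.exp_pos]

theorem bracket_negInf_upper_pos (k : ℤ) : 0 < bracket n m .negInf (.upper k) := by
  simp [bracket, Vertex.vec, Real.exp_pos]

theorem bracket_posInf_pos {u : Vertex} (h : u ≠ .posInf) : 0 < bracket n m .posInf u := by
  cases u <;> simp_all [bracket, Vertex.vec]

theorem bracket_ne_zero (hn : 0 < n) {u v : Vertex} (h : u ≠ v) : bracket n m u v ≠ 0 := by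
  have key : 0 < bracket n m u v ∨ 0 < bracket n m v u := by
    by_cases hu : u = .posInf
    · subst hu; exact Or.inl (bracket_posInf_pos h.symm)
    by_cases hv : v = .posInf
    · subst hv; exact Or.inr (bracket_posInf_pos h)
    cases u with
    | posInf => simp at hu
    | lower k =>
      cases v with
      | posInf => simp at hv
      | lower l =>
        rcases lt_trichotomy k l with h' | rfl | h'
        · exact Or.inr (bracket_lower_lower_pos h')
        · simp at h
        · exact Or.inl (bracket_lower_lower_pos h')
      | upper l => exact Or.inl (bracket_lower_upper_pos k l)
      | negInf => exact Or.inl (bracket_lower_negInf_pos k)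
    | upper k =>
      cases v with
      | posInf => simp at hv
      | upper l =>
        rcases lt_trichotomy k l with h' | rfl | h'
        · exact Or.inl (bracket_upper_upper_pos hn h')
        · simp at h
        · exact Or.inr (bracket_upper_upper_pos hn h')
      | lower l => exact Or.inr (bracket_lower_upper_pos l k)
      | negInf => exact Or.inr (bracket_negInf_upper_pos k)
    | negInf =>
      cases v with
      | posInf => simp at hv
      | upper l => exact Or.inl (bracket_negInf_upper_pos l)
      | lower l => exact Or.inr (bracket_lower_negInf_pos l)
      | negInf => simp at h
  rcases key with h' | h'
  · exact h'.ne'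
  · rw [bracket_swap]; exact (neg_neg_of_pos h').ne

theorem ne_of_crossing_neg {u v x y : Vertex} (h : crossing n m u v x y < 0) : u ≠ v := by
  rintro rfl
  exact h.not_ge (mul_self_nonneg _)

end bracket

/-! ## Crossing curves in the strip meet -/

/-- The linear form `w y - x` on the upper half plane that vanishes at the vertex with the
homogeneous coordinates `(x, y)`. -/
def linForm (n m : ℕ) (u : Vertex) (w : ℂ) : ℂ := w * (u.vec n m).2 - (u.vec n m).1

theorem linForm_ne_zero {n m : ℕ} (u : Vertex) {w : ℂ} (hw : w.im ≠ 0) : linForm n m u w ≠ 0 := by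
  intro h
  have h2 : w.im = 0 ∨ (u.vec n m).2 = 0 := by simpa [linForm] using congrArg Complex.im h
  cases u <;> simp_all [linForm, Vertex.vec]

/-- A Möbius transformation that maps `u` to `0` and `v` to `∞`. -/
def moebius (n m : ℕ) (u v : Vertex) (w : ℂ) : ℂ := linForm n m u w / linForm n m v w

/-- The bracket is the determinant of the transformation, so its sign decides into which half plane
the upper half plane is mapped. -/
theorem moebius_im {n m : ℕ} (u v : Vertex) (w : ℂ) :
    (moebius n m u v w).im = bracket n m u v * (w.im / Complex.normSq (linForm n m v w)) := by
  rw [moebius, Complex.div_im, bracket]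
  simp only [linForm, Complex.sub_im, Complex.sub_re, Complex.mul_im, Complex.mul_re,
    Complex.ofReal_im, Complex.ofReal_re]
  ring

theorem moebius_injOn {n m : ℕ} {u v : Vertex} (h : bracket n m u v ≠ 0) {w z : ℂ}
    (hw : w.im ≠ 0) (hz : z.im ≠ 0) (hwz : moebius n m u v w = moebius n m u v z) : w = z := by
  rw [moebius, moebius, div_eq_div_iff (linForm_ne_zero v hw) (linForm_ne_zero v hz)] at hwz
  have h' : (w - z) * (bracket n m u v : ℂ) = 0 := by
    simp only [linForm, bracket] at *
    push_cast
    linear_combination hwz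
  rcases mul_eq_zero.1 h' with h' | h'
  · exact sub_eq_zero.1 h'
  · exact absurd (by exact_mod_cast h') h

/-- The transformation extends continuously to the boundary away from `v`, and the linear forms take
the brackets as values on the homogeneous coordinates of `x`. -/
theorem tendsto_moebius {n m : ℕ} {u v x : Vertex} (hx : bracket n m x v ≠ 0) :
    Tendsto (fun p => moebius n m u v (toHalfPlane p)) (x.toFilter n m)
      (𝓝 ((bracket n m x u / bracket n m x v : ℝ) : ℂ)) := by
  have finite : ∀ x : Vertex, bracket n m x v ≠ 0 → (x.vec n m).2 = 1 →
      Tendsto toHalfPlane (x.toFilter n m) (𝓝 ((x.vec n m).1 : ℂ)) →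
      Tendsto (fun p => moebius n m u v (toHalfPlane p)) (x.toFilter n m)
        (𝓝 ((bracket n m x u / bracket n m x v : ℝ) : ℂ)) := by
    intro x hx h1 h
    have e : ∀ z : Vertex, ((bracket n m x z : ℝ) : ℂ) =
        ((x.vec n m).1 : ℂ) * (z.vec n m).2 - (z.vec n m).1 := by
      intro z; simp [bracket, h1]
    rw [Complex.ofReal_div, e, e]
    refine Tendsto.div ((h.mul_const _).sub_const _) ((h.mul_const _).sub_const _) ?_
    rw [← e]; exact_mod_cast hx
  cases x with
  | lower k =>
    refine finite _ hx rfl (continuous_toHalfPlane.tendsto' _ _ ?_)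
    by_cases hm : m = 0 <;> simp [toHalfPlane, Vertex.vec, hm]
  | upper k =>
    refine finite _ hx rfl (continuous_toHalfPlane.tendsto' _ _ ?_)
    simp [toHalfPlane, Vertex.vec, mul_add, Complex.exp_add]
  | negInf =>
    refine finite _ hx rfl ?_
    have h0 : Tendsto toHalfPlane (Vertex.negInf.toFilter n m) (𝓝 0) := by
      rw [tendsto_zero_iff_norm_tendsto_zero]
      simp only [norm_toHalfPlane]
      exact Real.tendsto_exp_atBot.comp
        ((tendsto_const_mul_atBot_of_pos Real.pi_pos).2 tendsto_fst)
    simpa [Vertex.vec] using h0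
  | posInf =>
    -- At `posInf` the numerator and the denominator are both divided by the point itself, whose
    -- inverse tends to `0`.
    have h0 : Tendsto (fun p => (toHalfPlane p)⁻¹) (Vertex.posInf.toFilter n m) (𝓝 0) := by
      rw [tendsto_zero_iff_norm_tendsto_zero]
      simp only [norm_inv, norm_toHalfPlane]
      exact tendsto_inv_atTop_zero.comp (Real.tendsto_exp_atTop.comp
        ((tendsto_const_mul_atTop_of_pos Real.pi_pos).2 tendsto_fst))
    have e : ∀ z : Vertex, ((bracket n m .posInf z : ℝ) : ℂ) =
        (z.vec n m).2 - 0 * (z.vec n m).1 := by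
      intro z; simp [bracket, Vertex.vec]
    rw [Complex.ofReal_div, e, e]
    refine Tendsto.congr (fun p => ?_) (Tendsto.div (tendsto_const_nhds.sub (h0.mul_const _))
      (tendsto_const_nhds.sub (h0.mul_const _)) (by rw [← e]; exact_mod_cast hx))
    have hp : toHalfPlane p ≠ 0 := Complex.exp_ne_zero _
    rw [moebius, linForm, linForm, Pi.div_apply, ← mul_div_mul_left _ _ hp]
    congr 1 <;> field_simp

/-- Curves in the strip whose ends separate each other meet. -/
theorem exists_eq_of_crossing_neg {n m : ℕ} (hn : 0 < n) {γ δ : ℝ → ℝ × ℝ} {u v x y : Vertex}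
    (h : crossing n m u v x y < 0) (hγ : Continuous γ) (hδ : Continuous δ)
    (hγs : ∀ t, γ t ∈ openStrip) (hδs : ∀ t, δ t ∈ openStrip)
    (hγu : Tendsto γ atBot (u.toFilter n m)) (hγv : Tendsto γ atTop (v.toFilter n m))
    (hδx : Tendsto δ atBot (x.toFilter n m)) (hδy : Tendsto δ atTop (y.toFilter n m)) :
    ∃ s t, γ s = δ t := by
  have huv : bracket n m u v ≠ 0 := bracket_ne_zero hn (ne_of_crossing_neg h)
  have hvu : bracket n m v u ≠ 0 := bracket_ne_zero hn (ne_of_crossing_neg h).symm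
  have h4 : bracket n m x u ≠ 0 ∧ bracket n m x v ≠ 0 ∧ bracket n m y u ≠ 0 ∧
      bracket n m y v ≠ 0 := by
    rw [← crossing_comm] at h
    refine ⟨?_, ?_, ?_, ?_⟩ <;> intro h' <;> simp [crossing, h'] at h
  have him : ∀ p ∈ openStrip, 0 < bracket n m u v * (moebius n m u v (toHalfPlane p)).im := by
    intro p hp
    have hp' := toHalfPlane_im_pos hp
    rw [moebius_im, ← mul_assoc]
    exact mul_pos (mul_self_pos.2 huv)
      (div_pos hp' (Complex.normSq_pos.2 (linForm_ne_zero v hp'.ne')))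
  have hcont : ∀ γ : ℝ → ℝ × ℝ, Continuous γ → (∀ t, γ t ∈ openStrip) →
      Continuous fun t => moebius n m u v (toHalfPlane (γ t)) := by
    intro γ hγ hγs
    have := continuous_toHalfPlane.comp hγ
    refine Continuous.div (by unfold linForm; fun_prop) (by unfold linForm; fun_prop) fun t => ?_
    exact linForm_ne_zero v (toHalfPlane_im_pos (hγs t)).ne'
  -- With `u` moved to `0` and `v` to `∞`, separation means that the images of `x` and `y` are real
  -- numbers of opposite signs: their product is the crossing number divided by a square.
  obtain ⟨s, t, hst⟩ := exists_eq_of_im_pos_of_mul_neg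
    (γ := fun t => moebius n m u v (toHalfPlane (γ t)))
    (δ := fun t => moebius n m u v (toHalfPlane (δ t))) (hcont γ hγ hγs) (hcont δ hδ hδs)
    (σ := bracket n m u v) (fun t => him _ (hγs t)) (fun t => him _ (hδs t))
    (by simpa [bracket_self, Function.comp_def] using (tendsto_moebius (u := u) huv).comp hγu)
    (by
      have h0 : Tendsto (fun t => ‖moebius n m v u (toHalfPlane (γ t))‖) atTop (𝓝[>] 0) := by
        refine tendsto_nhdsWithin_iff.2 ⟨?_, Eventually.of_forall fun t => norm_pos_iff.2 ?_⟩
        · simpa [bracket_self] using ((tendsto_moebius (u := v) hvu).comp hγv).norm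
        · have := (toHalfPlane_im_pos (hγs t)).ne'
          exact div_ne_zero (linForm_ne_zero v this) (linForm_ne_zero u this)
      refine (tendsto_inv_nhdsGT_zero.comp h0).congr fun t => ?_
      simp [moebius])
    (by
      rw [← crossing_comm] at h
      have e : bracket n m x u / bracket n m x v * (bracket n m y u / bracket n m y v) =
          crossing n m x y u v / (bracket n m x v * bracket n m y v) ^ 2 := by
        unfold crossing
        obtain ⟨h1, h2, h3, h4⟩ := h4
        field_simp
      rw [e]
      exact div_neg_of_neg_of_pos h (by have := mul_ne_zero h4.2.1 h4.2.2.2; positivity))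
    ((tendsto_moebius h4.2.1).comp hδx) ((tendsto_moebius h4.2.2.2).comp hδy)
  have := moebius_injOn huv (toHalfPlane_im_pos (hγs s)).ne' (toHalfPlane_im_pos (hδs t)).ne' hst
  refine ⟨s, t, ?_⟩
  rw [← ofHalfPlane_toHalfPlane (hγs s), this, ofHalfPlane_toHalfPlane (hδs t)]

/-! ## Geodesics -/

/-- The quadratic form that vanishes on the geodesic of the upper half plane with the ends `u` and
`v`. -/
def geodesicForm (n m : ℕ) (u v : Vertex) (w : ℂ) : ℝ :=
  (linForm n m u w * star (linForm n m v w)).re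

theorem geodesicForm_self_pos {n m : ℕ} (u : Vertex) {w : ℂ} (hw : w.im ≠ 0) :
    0 < geodesicForm n m u u w := by
  have : geodesicForm n m u u w = Complex.normSq (linForm n m u w) := by
    simp [geodesicForm, Complex.normSq_apply]
  rw [this]
  exact Complex.normSq_pos.2 (linForm_ne_zero u hw)

/-- By Cramer's rule `[c, d] a = [a, d] c + [c, a] d` for the homogeneous coordinates, and likewise
for `b`. The form is bilinear and symmetric in its two vertices, so it can be expanded in `c` and
`d`. -/
theorem geodesicForm_eq {n m : ℕ} (a b c d : Vertex) (w : ℂ) :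
    bracket n m c d ^ 2 * geodesicForm n m a b w =
      bracket n m a d * bracket n m b d * geodesicForm n m c c w +
      bracket n m c a * bracket n m c b * geodesicForm n m d d w +
      (bracket n m a d * bracket n m c b + bracket n m c a * bracket n m b d) *
        geodesicForm n m c d w := by
  simp only [geodesicForm, linForm, bracket, Complex.mul_re, Complex.sub_re, Complex.sub_im,
    Complex.mul_im, Complex.ofReal_re, Complex.ofReal_im, Complex.star_def, Complex.conj_re,
    Complex.conj_im]
  ring

/-- Geodesics whose ends do not separate each other are disjoint or equal. -/
theorem ends_eq_of_geodesicForm_eq_zero {n m : ℕ} (hn : 0 < n) {a b c d : Vertex} {w : ℂ}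
    (hw : w.im ≠ 0) (hcd : c ≠ d) (h : 0 ≤ crossing n m a b c d)
    (hab : geodesicForm n m a b w = 0) (hcdw : geodesicForm n m c d w = 0) :
    (a = c ∧ b = d) ∨ (a = d ∧ b = c) := by
  have key := geodesicForm_eq (n := n) (m := m) a b c d w
  rw [hab, hcdw] at key
  have h1 := geodesicForm_self_pos (n := n) (m := m) c hw
  have h2 := geodesicForm_self_pos (n := n) (m := m) d hw
  -- At a common point the expansion reduces to `X * G c + Y * G d = 0` with positive values `G c`,
  -- `G d` of the forms of `c` and `d` with themselves. As `X * Y` is the crossing number and not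
  -- negative, `X = Y = 0`, so both `c` and `d` occur among `a`, `b`.
  set X := bracket n m a d * bracket n m b d with hX
  have hY : bracket n m c a * bracket n m c b = bracket n m a c * bracket n m b c := by
    rw [bracket_swap c a, bracket_swap c b]; ring
  rw [hY] at key
  set Y := bracket n m a c * bracket n m b c with hY'
  have hXY : 0 ≤ X * Y := by
    have : crossing n m a b c d = X * Y := by rw [hX, hY', crossing]; ring
    rwa [← this]
  have hX0 : X = 0 := by
    have : X ^ 2 * geodesicForm n m c c w = -(X * Y * geodesicForm n m d d w) := by
      linear_combination -X * key
    have h3 : X ^ 2 * geodesicForm n m c c w ≤ 0 := by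
      rw [this]; exact neg_nonpos.2 (mul_nonneg hXY h2.le)
    have h4 : X ^ 2 ≤ 0 := nonpos_of_mul_nonpos_left h3 h1
    exact pow_eq_zero_iff two_ne_zero |>.1 (le_antisymm h4 (sq_nonneg _))
  have hY0 : Y = 0 := by
    rw [hX0] at key
    have : Y * geodesicForm n m d d w = 0 := by linear_combination -key
    exact (mul_eq_zero.1 this).resolve_right h2.ne'
  have e : ∀ {u v : Vertex}, bracket n m u v = 0 → u = v := fun h => by
    by_contra h'; exact bracket_ne_zero hn h' h
  rcases mul_eq_zero.1 hX0 with h3 | h3 <;> rcases mul_eq_zero.1 hY0 with h4 | h4 <;>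
    have h3 := e h3 <;> have h4 := e h4 <;> subst h3
  · exact absurd h4.symm hcd
  · exact Or.inr ⟨rfl, h4⟩
  · exact Or.inl ⟨h4, rfl⟩
  · exact absurd h4.symm hcd

/-- The geodesic of the upper half plane from `u` to `v`, if `σ` has the sign of
`bracket n m v u`. -/
def geodesic (n m : ℕ) (σ : ℝ) (u v : Vertex) (t : ℝ) : ℂ :=
  ((u.vec n m).1 + σ * Real.exp t * (v.vec n m).1 * Complex.I) /
    ((u.vec n m).2 + σ * Real.exp t * (v.vec n m).2 * Complex.I)

section geodesic

variable {n m : ℕ} {σ : ℝ} {u v : Vertex}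

theorem geodesic_den_ne_zero (h : 0 < σ * bracket n m v u) (t : ℝ) :
    ((u.vec n m).2 + σ * Real.exp t * (v.vec n m).2 * Complex.I : ℂ) ≠ 0 := by
  have hσ : σ ≠ 0 := by rintro rfl; simp at h
  intro h0
  have h1 : (u.vec n m).2 = 0 := by
    simpa [-Complex.ofReal_exp] using congrArg Complex.re h0
  have h2 : (v.vec n m).2 = 0 := by
    simpa [-Complex.ofReal_exp, hσ] using congrArg Complex.im h0
  simp [bracket, h1, h2] at h

theorem geodesic_mul (h : 0 < σ * bracket n m v u) (t : ℝ) :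
    geodesic n m σ u v t * ((u.vec n m).2 + σ * Real.exp t * (v.vec n m).2 * Complex.I : ℂ) =
      ((u.vec n m).1 + σ * Real.exp t * (v.vec n m).1 * Complex.I : ℂ) :=
  div_mul_cancel₀ _ (geodesic_den_ne_zero h t)

theorem geodesic_im_pos (h : 0 < σ * bracket n m v u) (t : ℝ) :
    0 < (geodesic n m σ u v t).im := by
  have h0 := Complex.normSq_pos.2 (geodesic_den_ne_zero h t)
  have : (geodesic n m σ u v t).im = Real.exp t * (σ * bracket n m v u) /
      Complex.normSq ((u.vec n m).2 + σ * Real.exp t * (v.vec n m).2 * Complex.I : ℂ) := by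
    rw [geodesic, Complex.div_im, bracket]
    simp only [Complex.add_im, Complex.add_re, Complex.mul_im, Complex.mul_re, Complex.ofReal_im,
      Complex.ofReal_re, Complex.I_re, Complex.I_im]
    ring
  rw [this]
  exact div_pos (mul_pos (Real.exp_pos _) h) h0

/-- Along the parametrization the linear forms of `u` and `v` differ by a purely imaginary factor,
so their Hermitian product has real part zero. -/
theorem geodesicForm_geodesic (h : 0 < σ * bracket n m v u) (t : ℝ) :
    geodesicForm n m u v (geodesic n m σ u v t) = 0 := by
  have h1 : linForm n m u (geodesic n m σ u v t) =
      ((-(σ * Real.exp t) : ℝ) : ℂ) * Complex.I * linForm n m v (geodesic n m σ u v t) := by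
    have := geodesic_mul h t
    simp only [linForm]
    push_cast [-Complex.ofReal_exp]
    linear_combination this
  rw [geodesicForm, h1, mul_assoc, Complex.star_def, Complex.mul_conj, mul_assoc,
    Complex.re_ofReal_mul, Complex.re_mul_ofReal]
  simp

theorem geodesic_injective (h : 0 < σ * bracket n m v u) :
    Function.Injective (geodesic n m σ u v) := by
  intro s t hst
  have h1 := geodesic_mul h s
  have h2 := geodesic_mul h t
  rw [hst] at h1
  have e : (Real.exp s - Real.exp t : ℂ) * ((σ * bracket n m v u : ℝ) : ℂ) = 0 := by
    rw [bracket]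
    push_cast [-Complex.ofReal_exp]
    linear_combination Complex.I *
      ((u.vec n m).2 + σ * Real.exp t * (v.vec n m).2 * Complex.I : ℂ) * h1 - Complex.I *
      ((u.vec n m).2 + σ * Real.exp s * (v.vec n m).2 * Complex.I : ℂ) * h2 +
      σ * (Real.exp s - Real.exp t : ℂ) *
        ((v.vec n m).1 * (u.vec n m).2 - (u.vec n m).1 * (v.vec n m).2 : ℂ) * Complex.I_sq
  have := (mul_eq_zero.1 e).resolve_right (by exact_mod_cast h.ne')
  have : Real.exp s = Real.exp t := by exact_mod_cast sub_eq_zero.1 this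
  exact Real.exp_injective this

theorem continuous_geodesic (h : 0 < σ * bracket n m v u) : Continuous (geodesic n m σ u v) :=
  Continuous.div (by fun_prop) (by fun_prop) (geodesic_den_ne_zero h)

/-- Reversal exchanges the ends, so only the limit at the source has to be computed directly. -/
theorem geodesic_neg (h : 0 < σ * bracket n m v u) (t : ℝ) :
    geodesic n m (-σ⁻¹) v u (-t) = geodesic n m σ u v t := by
  have hσ : σ ≠ 0 := by rintro rfl; simp at h
  have hσ' : (σ : ℂ) ≠ 0 := by exact_mod_cast hσ
  have ht : (Real.exp t : ℂ) ≠ 0 := by exact_mod_cast (Real.exp_pos t).ne'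
  have hc : (σ * Real.exp t * Complex.I : ℂ) ≠ 0 := by simp [hσ]
  rw [geodesic, geodesic, ← mul_div_mul_left _ _ hc, Real.exp_neg]
  push_cast at *
  congr 1 <;> field_simp
  · linear_combination -((u.vec n m).1 : ℂ) * Complex.I_sq
  · linear_combination -((u.vec n m).2 : ℂ) * Complex.I_sq

/-- Used at the ends of the strip, where the geodesic converges only after rescaling by `exp (r t)`.
A rescaled limit on the positive imaginary axis gives the height `1 / 2`, and a first coordinate
that is `-r t / π` up to a bounded error. -/
theorem tendsto_ofHalfPlane_of_smul {l : Filter ℝ} {r : ℝ → ℝ} {z : ℝ → ℂ} {c : ℝ} (hc : 0 < c)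
    (h : Tendsto (fun t => (Real.exp (r t) : ℂ) * z t) l (𝓝 (c * Complex.I))) :
    (∀ᶠ t in l, (ofHalfPlane (z t)).1 =
      (Real.log ‖(Real.exp (r t) : ℂ) * z t‖ - r t) / Real.pi) ∧
    Tendsto (fun t => Real.log ‖(Real.exp (r t) : ℂ) * z t‖) l (𝓝 (Real.log c)) ∧
    Tendsto (fun t => (ofHalfPlane (z t)).2) l (𝓝 (1 / 2)) := by
  have hn : Tendsto (fun t => ‖(Real.exp (r t) : ℂ) * z t‖) l (𝓝 c) := by
    simpa [abs_of_pos hc] using h.norm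
  refine ⟨?_, hn.log hc.ne', ?_⟩
  · filter_upwards [hn.eventually (lt_mem_nhds hc)] with t ht
    have hz : ‖z t‖ ≠ 0 := by
      intro h0; rw [norm_mul, h0, mul_zero] at ht; exact ht.false
    rw [norm_mul, Complex.norm_real, Real.norm_of_nonneg (Real.exp_pos _).le,
      Real.log_mul (Real.exp_pos _).ne' hz, Real.log_exp, ofHalfPlane]
    ring
  · have ha : (c * Complex.I).arg = Real.pi / 2 := by
      rw [Complex.arg_real_mul _ hc, Complex.arg_I]
    have h1 : ContinuousAt Complex.arg (c * Complex.I) :=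
      Complex.continuousAt_arg (by simp [Complex.mem_slitPlane_iff, hc.ne'])
    have := (h1.tendsto.comp h).div_const Real.pi
    rw [ha] at this
    have hπ := Real.pi_ne_zero
    refine (this.congr fun t => ?_).mono_right (le_of_eq (by congr 1; field_simp))
    simp only [Function.comp, ofHalfPlane, Complex.arg_real_mul _ (Real.exp_pos _)]

theorem tendsto_geodesic_src (h : 0 < σ * bracket n m v u) :
    Tendsto (fun t => ofHalfPlane (geodesic n m σ u v t)) atBot (u.toFilter n m) := by
  have hexp : Tendsto (fun t : ℝ => (Real.exp t : ℂ)) atBot (𝓝 0) := by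
    exact_mod_cast (Complex.continuous_ofReal.tendsto _).comp Real.tendsto_exp_atBot
  have hnum : ∀ a b : ℝ, Tendsto (fun t : ℝ => (a + σ * Real.exp t * b * Complex.I : ℂ)) atBot
      (𝓝 a) := fun a b => by
    simpa using tendsto_const_nhds.add
      (((hexp.const_mul (σ : ℂ)).mul_const (b : ℂ)).mul_const Complex.I)
  have finite : (u.vec n m).1 ≠ 0 → (u.vec n m).2 = 1 →
      𝓝 (ofHalfPlane (u.vec n m).1) = u.toFilter n m →
      Tendsto (fun t => ofHalfPlane (geodesic n m σ u v t)) atBot (u.toFilter n m) := by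
    intro h0 h1 h2
    have h3 : Tendsto (geodesic n m σ u v) atBot (𝓝 (u.vec n m).1) := by
      have := (hnum (u.vec n m).1 (v.vec n m).1).div (hnum (u.vec n m).2 (v.vec n m).2)
        (by simp [h1])
      simp only [h1, Complex.ofReal_one, div_one] at this
      refine this.congr fun t => ?_
      rw [Pi.div_apply, geodesic, h1, Complex.ofReal_one]
    rw [← h2]
    refine (continuousWithinAt_ofHalfPlane (by exact_mod_cast h0)).tendsto.comp
      (tendsto_nhdsWithin_iff.2 ⟨h3, Eventually.of_forall fun t => (geodesic_im_pos h t).le⟩)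
  have hπ := Real.pi_pos
  cases u with
  | lower k =>
    refine finite (Real.exp_pos _).ne' rfl ?_
    simp only [Vertex.vec, Vertex.toFilter, ofHalfPlane, Complex.norm_real,
      Real.norm_of_nonneg (Real.exp_pos _).le, Real.log_exp,
      Complex.arg_ofReal_of_nonneg (Real.exp_pos _).le]
    congr 2
    · field_simp
    · simp
  | upper k =>
    refine finite (neg_neg_of_pos (Real.exp_pos _)).ne rfl ?_
    simp only [Vertex.vec, Vertex.toFilter, ofHalfPlane, Complex.norm_real, norm_neg,
      Real.norm_of_nonneg (Real.exp_pos _).le, Real.log_exp,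
      Complex.arg_ofReal_of_neg (neg_neg_of_pos (Real.exp_pos _))]
    congr 2 <;> field_simp
  | negInf =>
    have hc : 0 < σ * (v.vec n m).1 := by simpa [bracket, Vertex.vec] using h
    obtain ⟨h1, h2, h3⟩ := tendsto_ofHalfPlane_of_smul (l := atBot) (r := fun t => -t)
      (z := geodesic n m σ .negInf v) hc (by
        have := (tendsto_const_nhds (x := (σ * (v.vec n m).1 * Complex.I : ℂ)) (f := atBot)).div
          (hnum 1 (v.vec n m).2) (by simp)
        simp only [Complex.ofReal_one, div_one] at this
        rw [Complex.ofReal_mul]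
        refine this.congr fun t => ?_
        have h0 : (Real.exp t : ℂ) ≠ 0 := by exact_mod_cast (Real.exp_pos t).ne'
        rw [Pi.div_apply, geodesic, Real.exp_neg, Complex.ofReal_inv, mul_div_assoc']
        generalize Real.exp t = E at h0 ⊢
        congr 1
        · simp only [show (Vertex.negInf.vec n m).1 = 0 from rfl, Complex.ofReal_zero, zero_add]
          field_simp)
    refine tendsto_prod_iff'.2 ⟨?_, h3⟩
    refine Tendsto.congr' (EventuallyEq.symm h1) ((tendsto_div_const_atBot_of_pos hπ).2 ?_)
    simp only [sub_neg_eq_add]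
    exact h2.add_atBot tendsto_id
  | posInf =>
    have hc : 0 < σ * -(v.vec n m).2 := by simpa [bracket, Vertex.vec] using h
    obtain ⟨h1, h2, h3⟩ := tendsto_ofHalfPlane_of_smul (l := atBot) (r := fun t => t)
      (z := geodesic n m σ .posInf v) (inv_pos.2 hc) (by
        have hd : (σ * (v.vec n m).2 * Complex.I : ℂ) ≠ 0 := by
          have h1 : σ * (v.vec n m).2 ≠ 0 := by intro h0; rw [mul_neg, h0] at hc; simp at hc
          exact mul_ne_zero (by exact_mod_cast h1) Complex.I_ne_zero
        have := (hnum 1 (v.vec n m).1).div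
          (tendsto_const_nhds (x := (σ * (v.vec n m).2 * Complex.I : ℂ)) (f := atBot)) hd
        refine (this.congr fun t => ?_).mono_right (le_of_eq ?_)
        · have h0 : (Real.exp t : ℂ) ≠ 0 := by exact_mod_cast (Real.exp_pos t).ne'
          rw [Pi.div_apply, geodesic, ← mul_div_mul_left _ _ h0, mul_div_assoc']
          generalize Real.exp t = E
          congr 1
          simp only [show (Vertex.posInf.vec n m).2 = 0 from rfl, Complex.ofReal_zero, zero_add]
          ring
        · congr 1
          have h1 : (σ : ℂ) ≠ 0 := by rintro h; simp [h] at hd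
          have h2 : ((v.vec n m).2 : ℂ) ≠ 0 := by rintro h; simp [h] at hd
          push_cast
          field_simp
          simp)
    refine tendsto_prod_iff'.2 ⟨?_, h3⟩
    refine Tendsto.congr' (EventuallyEq.symm h1) ((tendsto_div_const_atTop_of_pos hπ).2 ?_)
    exact h2.add_atTop tendsto_neg_atBot_atTop

theorem tendsto_geodesic_tgt (h : 0 < σ * bracket n m v u) :
    Tendsto (fun t => ofHalfPlane (geodesic n m σ u v t)) atTop (v.toFilter n m) := by
  have h' : 0 < -σ⁻¹ * bracket n m u v := by
    rw [bracket_swap, neg_mul_neg]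
    have hσ : σ ≠ 0 := by rintro rfl; simp at h
    have : σ⁻¹ * bracket n m v u = σ * bracket n m v u * (σ⁻¹) ^ 2 := by field_simp
    rw [this]; positivity
  refine ((tendsto_geodesic_src h').comp tendsto_neg_atTop_atBot).congr fun t => ?_
  simp only [Function.comp, geodesic_neg h]

end geodesic

/-- The dilation that represents the deck transformation rescales homogeneous coordinates. Unmarked
upper vertices must be excluded: for `m = 0` the shift fixes them, but the deck transformation moves
their positions. -/
theorem linForm_shift {n m : ℕ} {u : Vertex} (hu : u.IsMarked m ∨ u.IsInfinite) (j : ℤ) :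
    ∃ c : ℝ, c ≠ 0 ∧ ∀ p, linForm n m (u.shift n m j) (toHalfPlane (deck n m j p)) =
      c * linForm n m u (toHalfPlane p) := by
  have hne := (Real.exp_pos (Real.pi * (j * period n m))).ne'
  simp only [toHalfPlane_deck, linForm]
  cases u with
  | posInf => exact ⟨1, one_ne_zero, fun p => by simp [Vertex.shift, Vertex.vec]⟩
  | negInf => exact ⟨_, hne, fun p => by simp [Vertex.shift, Vertex.vec]⟩
  | lower k =>
    refine ⟨_, hne, fun p => ?_⟩
    have e : ((Vertex.lower k).shift n m j).vec n m =
        (Real.exp (Real.pi * (j * period n m)) * ((Vertex.lower k).vec n m).1, 1) := by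
      simp only [Vertex.shift, Vertex.vec, ← Real.exp_add]
      by_cases hm : m = 0 <;> simp [period, hm] <;> ring
    rw [e]
    simp only [Vertex.vec]
    push_cast
    ring
  | upper k =>
    refine ⟨_, hne, fun p => ?_⟩
    have hm : m ≠ 0 := by simpa [Vertex.IsMarked, Vertex.IsInfinite] using hu
    have e : ((Vertex.upper k).shift n m j).vec n m =
        (Real.exp (Real.pi * (j * period n m)) * ((Vertex.upper k).vec n m).1, 1) := by
      simp only [Vertex.shift, Vertex.vec, mul_neg, ← Real.exp_add]
      simp [period, hm]
      ring
    rw [e]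
    simp only [Vertex.vec]
    push_cast
    ring

theorem geodesicForm_shift {n m : ℕ} {u v : Vertex} (hu : u.IsMarked m ∨ u.IsInfinite)
    (hv : v.IsMarked m ∨ v.IsInfinite) (j : ℤ) {p : ℝ × ℝ}
    (h : geodesicForm n m u v (toHalfPlane p) = 0) :
    geodesicForm n m (u.shift n m j) (v.shift n m j) (toHalfPlane (deck n m j p)) = 0 := by
  obtain ⟨c, -, hc⟩ := linForm_shift (n := n) hu j
  obtain ⟨d, -, hd⟩ := linForm_shift (n := n) hv j
  have : (c * linForm n m u (toHalfPlane p)) * star (d * linForm n m v (toHalfPlane p)) =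
      ((c * d : ℝ) : ℂ) * (linForm n m u (toHalfPlane p) * star (linForm n m v (toHalfPlane p))) := by
    simp; ring
  rw [geodesicForm, hc, hd, this, Complex.re_ofReal_mul]
  exact mul_eq_zero_of_right _ h

/-! ## Arcs and their ends -/

theorem period_pos {n m : ℕ} (hn : 0 < n) : 0 < period n m := by
  unfold period
  split_ifs with h
  · exact_mod_cast hn
  · exact_mod_cast Nat.mul_pos hn (Nat.pos_of_ne_zero h)

theorem cover_eq_iff {n m : ℕ} {p q : ℝ × ℝ} :
    cover n m p = cover n m q ↔ ∃ j, p = deck n m j q := by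
  rw [cover, cover, Prod.mk.injEq, ← sub_eq_zero, ← AddCircle.coe_sub, AddCircle.coe_eq_zero_iff,
    ← exists_and_right]
  refine exists_congr fun j => ?_
  rw [deck, Prod.ext_iff]
  refine and_congr ⟨fun h => ?_, fun h => ?_⟩ Iff.rfl
  · rw [zsmul_eq_mul] at h; linarith
  · simp only at h; rw [zsmul_eq_mul]; linarith

theorem cover_deck {n m : ℕ} (j : ℤ) (p : ℝ × ℝ) : cover n m (deck n m j p) = cover n m p :=
  cover_eq_iff.2 ⟨j, rfl⟩

theorem eq_zero_of_deck_eq {n m : ℕ} (hn : 0 < n) {j : ℤ} {p : ℝ × ℝ} (h : deck n m j p = p) :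
    j = 0 := by
  have h1 : p.1 + j * period n m = p.1 := congrArg Prod.fst h
  have h2 : (j : ℝ) * period n m = 0 := by linarith
  exact_mod_cast (mul_eq_zero.1 h2).resolve_right (period_pos hn).ne'

theorem deck_zero (n m : ℕ) (p : ℝ × ℝ) : deck n m 0 p = p := by simp [deck]

theorem deck_mem_openStrip {n m : ℕ} {j : ℤ} {p : ℝ × ℝ} (hp : p ∈ openStrip) :
    deck n m j p ∈ openStrip := hp

theorem Vertex.isMarked_shift {n m : ℕ} {j : ℤ} {v : Vertex} :
    (v.shift n m j).IsMarked m ↔ v.IsMarked m := by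
  cases v <;> rfl

theorem Vertex.isInfinite_shift {n m : ℕ} {j : ℤ} {v : Vertex} :
    (v.shift n m j).IsInfinite ↔ v.IsInfinite := by
  cases v <;> rfl

theorem Vertex.shift_injective (n m : ℕ) (j : ℤ) : Function.Injective (Vertex.shift n m j) := by
  intro v w h
  rw [Vertex.eq_shift_iff] at h
  rw [h, Vertex.shift_shift, add_neg_cancel, Vertex.shift_zero]

theorem boundarySegment_shift {n m : ℕ} {j : ℤ} {v w : Vertex} :
    BoundarySegment m (v.shift n m j) (w.shift n m j) ↔ BoundarySegment m v w := by
  cases v <;> cases w <;> simp [BoundarySegment, Vertex.shift] <;> omega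

theorem boundarySegment_comm {m : ℕ} {v w : Vertex} :
    BoundarySegment m v w ↔ BoundarySegment m w v := by
  cases v <;> cases w <;> simp [BoundarySegment] <;> omega

/-- The vertices `u` and `v` are the ends of a curve that is not contractible or homotopic to a
boundary segment. -/
structure IsArcPair (m : ℕ) (u v : Vertex) : Prop where
  ends : (u.IsMarked m ∧ v.IsMarked m) ∨ (u.IsMarked m ∧ v.IsInfinite) ∨
    (u.IsInfinite ∧ v.IsMarked m)
  ne : u ≠ v
  not_boundary : ¬ BoundarySegment m u v

theorem IsArcPair.valid_left {m : ℕ} {u v : Vertex} (h : IsArcPair m u v) :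
    u.IsMarked m ∨ u.IsInfinite := by
  rcases h.ends with h | h | h <;> simp [h]

theorem IsArcPair.valid_right {m : ℕ} {u v : Vertex} (h : IsArcPair m u v) :
    v.IsMarked m ∨ v.IsInfinite := by
  rcases h.ends with h | h | h <;> simp [h]

theorem Vertex.eq_zero_of_shift_eq {n m : ℕ} (hn : 0 < n) {j : ℤ} {v : Vertex}
    (hv : v.IsMarked m) (h : v = v.shift n m j) : j = 0 := by
  cases v with
  | lower k =>
    have : j * n = 0 := by simpa [Vertex.shift] using h
    exact (mul_eq_zero.1 this).resolve_right (by exact_mod_cast hn.ne')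
  | upper k =>
    have : j * m = 0 := by simpa [Vertex.shift] using h
    exact (mul_eq_zero.1 this).resolve_right (by exact_mod_cast hv)
  | posInf => exact hv.elim
  | negInf => exact hv.elim

/-- Even if the ends are exchanged, the shift by `2 * j` fixes both of them, and one is marked,
hence moved by every nontrivial shift. -/
theorem IsArcPair.eq_zero_of_shift_eq {n m : ℕ} (hn : 0 < n) {j : ℤ} {u v : Vertex}
    (huv : IsArcPair m u v)
    (h : (u = u.shift n m j ∧ v = v.shift n m j) ∨ (u = v.shift n m j ∧ v = u.shift n m j)) :
    j = 0 := by
  have h2 : u = u.shift n m (j + j) ∧ v = v.shift n m (j + j) := by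
    rw [← Vertex.shift_shift, ← Vertex.shift_shift]
    rcases h with ⟨h1, h2⟩ | ⟨h1, h2⟩
    · exact ⟨h1.trans (congrArg _ h1), h2.trans (congrArg _ h2)⟩
    · exact ⟨h1.trans (congrArg _ h2), h2.trans (congrArg _ h1)⟩
  have h3 : j + j = 0 := by
    rcases huv.ends with h | h | h
    · exact Vertex.eq_zero_of_shift_eq hn h.1 h2.1
    · exact Vertex.eq_zero_of_shift_eq hn h.1 h2.1
    · exact Vertex.eq_zero_of_shift_eq hn h.2 h2.2
  omega

/-- The geodesic with given ends represents an arc if its translates do not cross it. -/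
def geodesicCurve {n m : ℕ} (hn : 0 < n) {u v : Vertex} (huv : IsArcPair m u v)
    (h : ∀ j, 0 ≤ crossing n m u v (u.shift n m j) (v.shift n m j)) : Curve n m :=
  -- Taking `σ = bracket n m v u` turns the sign condition on `σ` into positivity of a square.
  have hσ : 0 < bracket n m v u * bracket n m v u := mul_self_pos.2 (bracket_ne_zero hn huv.ne.symm)
  { src := u
    tgt := v
    toFun := fun t => ofHalfPlane (geodesic n m (bracket n m v u) u v t)
    continuous_toFun := by
      refine continuous_iff_continuousAt.2 fun t => ?_
      have him := geodesic_im_pos hσ t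
      have h0 : geodesic n m (bracket n m v u) u v t ≠ 0 := fun h => by simp [h] at him
      exact ((continuousWithinAt_ofHalfPlane h0).continuousAt
        (mem_of_superset (((isOpen_lt continuous_const Complex.continuous_im)).mem_nhds him)
          fun z (hz : 0 < z.im) => hz.le)).comp (continuous_geodesic hσ).continuousAt
    mem_openStrip := fun t => ofHalfPlane_mem_openStrip (geodesic_im_pos hσ t)
    tendsto_src := tendsto_geodesic_src hσ
    tendsto_tgt := tendsto_geodesic_tgt hσ
    ends := huv.ends
    not_closed := huv.ne
    not_boundary := huv.not_boundary
    simple := by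
      have hto : ∀ t, toHalfPlane (ofHalfPlane (geodesic n m (bracket n m v u) u v t)) =
          geodesic n m (bracket n m v u) u v t := fun t =>
        toHalfPlane_ofHalfPlane fun h0 => by simpa [h0] using geodesic_im_pos hσ t
      intro s t hst
      -- A self-intersection in the annulus is a common point of the geodesic and a translate. As
      -- these do not cross, they have the same ends, which forces the translation to be trivial.
      obtain ⟨j, hj⟩ := cover_eq_iff.1 hst
      have h1 := geodesicForm_geodesic hσ s
      have h2 := geodesicForm_geodesic hσ t
      rw [← hto] at h1 h2
      have h3 := geodesicForm_shift huv.valid_left huv.valid_right j h2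
      rw [← hj] at h3
      have hj0 : j = 0 := huv.eq_zero_of_shift_eq hn (ends_eq_of_geodesicForm_eq_zero hn
        (by rw [hto]; exact (geodesic_im_pos hσ s).ne')
        (fun e => huv.ne (Vertex.shift_injective n m j e)) (h j) h1 h3)
      rw [hj0, deck_zero] at hj
      refine geodesic_injective hσ ?_
      rw [← hto s, ← hto t, hj] }

theorem geodesicForm_geodesicCurve {n m : ℕ} (hn : 0 < n) {u v : Vertex} (huv : IsArcPair m u v)
    (h : ∀ j, 0 ≤ crossing n m u v (u.shift n m j) (v.shift n m j)) (t : ℝ) :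
    geodesicForm n m u v (toHalfPlane ((geodesicCurve hn huv h).toFun t)) = 0 := by
  have hσ : 0 < bracket n m v u * bracket n m v u := mul_self_pos.2 (bracket_ne_zero hn huv.ne.symm)
  have hto : toHalfPlane (ofHalfPlane (geodesic n m (bracket n m v u) u v t)) =
      geodesic n m (bracket n m v u) u v t :=
    toHalfPlane_ofHalfPlane fun h0 => by simpa [h0] using geodesic_im_pos hσ t
  change geodesicForm n m u v
    (toHalfPlane (ofHalfPlane (geodesic n m (bracket n m v u) u v t))) = 0
  rw [hto]
  exact geodesicForm_geodesic hσ t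

namespace Curve

variable {n m : ℕ}

theorem isArcPair (c : Curve n m) : IsArcPair m c.src c.tgt :=
  ⟨c.ends, c.not_closed, c.not_boundary⟩

/-- The curve with the opposite orientation. -/
def reverse (c : Curve n m) : Curve n m where
  src := c.tgt
  tgt := c.src
  toFun t := c.toFun (-t)
  continuous_toFun := c.continuous_toFun.comp continuous_neg
  mem_openStrip t := c.mem_openStrip _
  tendsto_src := c.tendsto_tgt.comp tendsto_neg_atBot_atTop
  tendsto_tgt := c.tendsto_src.comp tendsto_neg_atTop_atBot
  ends := by have := c.ends; tauto
  not_closed := c.not_closed.symm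
  not_boundary h := c.not_boundary (boundarySegment_comm.1 h)
  simple := c.simple.comp neg_injective

/-- The image of a lifted curve under a deck transformation. -/
def translate (j : ℤ) (c : Curve n m) : Curve n m where
  src := c.src.shift n m j
  tgt := c.tgt.shift n m j
  toFun t := deck n m j (c.toFun t)
  continuous_toFun := (continuous_deck n m j).comp c.continuous_toFun
  mem_openStrip t := deck_mem_openStrip (c.mem_openStrip t)
  tendsto_src := (tendsto_deck n m j c.src_valid).comp c.tendsto_src
  tendsto_tgt := (tendsto_deck n m j c.tgt_valid).comp c.tendsto_tgt
  ends := by simpa only [Vertex.isMarked_shift, Vertex.isInfinite_shift] using c.ends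
  not_closed h := c.not_closed (Vertex.shift_injective n m j h)
  not_boundary h := c.not_boundary (boundarySegment_shift.1 h)
  simple := by simpa only [cover_deck] using c.simple

theorem toArc_eq_iff {c d : Curve n m} : c.toArc = d.toArc ↔
    ∃ j : ℤ, (c.src = d.src.shift n m j ∧ c.tgt = d.tgt.shift n m j) ∨
      (c.src = d.tgt.shift n m j ∧ c.tgt = d.src.shift n m j) :=
  Quotient.eq.trans (c.equivalent_iff d)

theorem toArc_reverse (c : Curve n m) : c.reverse.toArc = c.toArc :=
  toArc_eq_iff.2 ⟨0, Or.inr (by simp [Vertex.shift_zero, reverse])⟩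

theorem toArc_translate (j : ℤ) (c : Curve n m) : (c.translate j).toArc = c.toArc :=
  toArc_eq_iff.2 ⟨j, Or.inl ⟨rfl, rfl⟩⟩

theorem toArc_eq_of_ends {c d : Curve n m} (h : c.src = d.src) (h' : c.tgt = d.tgt) :
    c.toArc = d.toArc :=
  toArc_eq_iff.2 ⟨0, Or.inl (by simp [Vertex.shift_zero, h, h'])⟩

theorem exists_eq_of_crossing_neg (hn : 0 < n) {c d : Curve n m}
    (h : crossing n m c.src c.tgt d.src d.tgt < 0) : ∃ s t, c.toFun s = d.toFun t :=
  AnnulusFrieze.exists_eq_of_crossing_neg hn h c.continuous_toFun d.continuous_toFun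
    c.mem_openStrip d.mem_openStrip c.tendsto_src c.tendsto_tgt d.tendsto_src d.tendsto_tgt

/-- Every lift of an arc is a translate of a given representative, up to orientation. -/
theorem exists_translate_of_toArc_eq {c d : Curve n m} (h : c.toArc = d.toArc) :
    ∃ (e : Curve n m) (j : ℤ), e.src = c.src ∧ e.tgt = c.tgt ∧
      ((∀ t, e.toFun t = deck n m j (d.toFun t)) ∨
        (∀ t, e.toFun t = deck n m j (d.toFun (-t)))) := by
  obtain ⟨j, h | h⟩ := toArc_eq_iff.1 h
  · exact ⟨d.translate j, j, h.1.symm, h.2.symm, Or.inl fun t => rfl⟩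
  · exact ⟨d.reverse.translate j, j, h.1.symm, h.2.symm, Or.inr fun t => rfl⟩

/-- Lifts of the same arc do not cross. -/
theorem crossing_nonneg_of_toArc_eq (hn : 0 < n) {c d : Curve n m} (h : c.toArc = d.toArc) :
    0 ≤ crossing n m c.src c.tgt d.src d.tgt := by
  by_contra! hneg
  -- Crossing lifts meet. Both can be taken to be translates of the simple curve `d`, so the
  -- parameters at the meeting point agree and the deck transformation is trivial. But then the
  -- pairs of ends coincide and the crossing number is `0`.
  have key : ∃ j : ℤ, ((c.src = d.src.shift n m j ∧ c.tgt = d.tgt.shift n m j) ∨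
      (c.src = d.tgt.shift n m j ∧ c.tgt = d.src.shift n m j)) ∧ j = 0 := by
    obtain ⟨j, h | h⟩ := toArc_eq_iff.1 h
    · obtain ⟨s, t, hst⟩ := exists_eq_of_crossing_neg hn (c := d.translate j) (d := d)
        (by rw [h.1, h.2] at hneg; exact hneg)
      have : s = t := d.simple (by
        simpa only [translate, cover_deck] using congrArg (cover n m) hst)
      subst this
      exact ⟨j, Or.inl h, eq_zero_of_deck_eq hn hst⟩
    · obtain ⟨s, t, hst⟩ := exists_eq_of_crossing_neg hn (c := d.translate j) (d := d)
        (by rw [h.1, h.2, crossing_swap_left] at hneg; exact hneg)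
      have : s = t := d.simple (by
        simpa only [translate, cover_deck] using congrArg (cover n m) hst)
      subst this
      exact ⟨j, Or.inr h, eq_zero_of_deck_eq hn hst⟩
  obtain ⟨_, h | h, rfl⟩ := key <;> rw [h.1, h.2] at hneg <;>
    simp [crossing, bracket_self, Vertex.shift_zero] at hneg

/-- Lifts of compatible arcs do not cross. -/
theorem crossing_nonneg_of_compatible (hn : 0 < n) {c d : Curve n m}
    (h : Compatible c.toArc d.toArc) : 0 ≤ crossing n m c.src c.tgt d.src d.tgt := by
  by_contra! hneg
  obtain ⟨c', d', hc, hd, hcd⟩ := h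
  -- The crossing number depends only on the ends, so `c` and `d` may be replaced by lifts of the
  -- disjoint representatives.
  obtain ⟨e, j, he1, he2, he⟩ := exists_translate_of_toArc_eq hc.symm
  obtain ⟨f, k, hf1, hf2, hf⟩ := exists_translate_of_toArc_eq hd.symm
  rw [← he1, ← he2, ← hf1, ← hf2] at hneg
  obtain ⟨s, t, hst⟩ := exists_eq_of_crossing_neg hn hneg
  have he' : ∃ s', cover n m (e.toFun s) = cover n m (c'.toFun s') := by
    rcases he with he | he <;> rw [he, cover_deck] <;> exact ⟨_, rfl⟩
  have hf' : ∃ t', cover n m (f.toFun t) = cover n m (d'.toFun t') := by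
    rcases hf with hf | hf <;> rw [hf, cover_deck] <;> exact ⟨_, rfl⟩
  obtain ⟨s', hs'⟩ := he'
  obtain ⟨t', ht'⟩ := hf'
  exact hcd s' t' (by rw [← hs', ← ht', hst])

end Curve

/-! ## Edges of a triangulation -/

section edge

variable {n m : ℕ} {T : Set (Arc n m)}

/-- `u` and `v` are the ends of an arc of the preimage of `T` in the strip. -/
def Edge (T : Set (Arc n m)) (u v : Vertex) : Prop :=
  ∃ c : Curve n m, c.toArc ∈ T ∧ c.src = u ∧ c.tgt = v

theorem Edge.isArcPair {u v : Vertex} (h : Edge T u v) : IsArcPair m u v := by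
  obtain ⟨c, -, rfl, rfl⟩ := h
  exact c.isArcPair

theorem Edge.symm {u v : Vertex} (h : Edge T u v) : Edge T v u := by
  obtain ⟨c, hc, rfl, rfl⟩ := h
  exact ⟨c.reverse, by rwa [c.toArc_reverse], rfl, rfl⟩

theorem edge_comm {u v : Vertex} : Edge T u v ↔ Edge T v u := ⟨Edge.symm, Edge.symm⟩

theorem Edge.shift {u v : Vertex} (h : Edge T u v) (j : ℤ) :
    Edge T (u.shift n m j) (v.shift n m j) := by
  obtain ⟨c, hc, rfl, rfl⟩ := h
  exact ⟨c.translate j, by rwa [c.toArc_translate], rfl, rfl⟩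

theorem Edge.crossing_nonneg (hn : 0 < n) (hT : IsTriangulation T) {u v x y : Vertex}
    (h : Edge T u v) (h' : Edge T x y) : 0 ≤ crossing n m u v x y := by
  obtain ⟨c, hc, rfl, rfl⟩ := h
  obtain ⟨d, hd, rfl, rfl⟩ := h'
  by_cases e : c.toArc = d.toArc
  · exact Curve.crossing_nonneg_of_toArc_eq hn e
  · exact Curve.crossing_nonneg_of_compatible hn (hT.1 hc hd e)

instance : Std.Symm (Compatible (n := n) (m := m)) where
  symm := by
    rintro A B ⟨c, d, hc, hd, h⟩
    exact ⟨d, c, hd, hc, fun s t => (h t s).symm⟩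

/-- The maximality of a triangulation: it contains every arc that its arcs do not cross. -/
theorem edge_of_crossing_nonneg (hn : 0 < n) (hT : IsTriangulation T) {u v : Vertex}
    (huv : IsArcPair m u v) (hself : ∀ j, 0 ≤ crossing n m u v (u.shift n m j) (v.shift n m j))
    (h : ∀ x y, Edge T x y → 0 ≤ crossing n m u v x y) : Edge T u v := by
  set c := geodesicCurve hn huv hself with hc
  have hins : (insert c.toArc T).Pairwise Compatible := by
    refine hT.1.insert_of_symm fun B hB hne => ?_
    obtain ⟨d₀, rfl⟩ : ∃ d₀ : Curve n m, d₀.toArc = B := Quotient.exists_rep B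
    have hd₀ : Edge T d₀.src d₀.tgt := ⟨d₀, hB, rfl, rfl⟩
    have hd₀' : ∀ j, 0 ≤ crossing n m d₀.src d₀.tgt (d₀.src.shift n m j) (d₀.tgt.shift n m j) :=
      fun j => hd₀.crossing_nonneg hn hT (hd₀.shift j)
    -- The given representative `d₀` is straightened to the geodesic with the same ends. If it met
    -- `c` in the annulus, a translate of it would have the ends of `c`, and the two arcs would be
    -- equal.
    set d := geodesicCurve hn d₀.isArcPair hd₀' with hd
    have hdd : d.toArc = d₀.toArc := Curve.toArc_eq_of_ends rfl rfl
    refine ⟨c, d, rfl, hdd, fun s t hst => hne ?_⟩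
    obtain ⟨j, hj⟩ := cover_eq_iff.1 hst
    have h1 := geodesicForm_geodesicCurve hn huv hself s
    have h2 := geodesicForm_shift d₀.isArcPair.valid_left d₀.isArcPair.valid_right j
      (geodesicForm_geodesicCurve hn d₀.isArcPair hd₀' t)
    rw [← hc, hj] at h1
    have h3 := ends_eq_of_geodesicForm_eq_zero hn
      (toHalfPlane_im_pos (deck_mem_openStrip (d.mem_openStrip t))).ne'
      (fun e => d₀.not_closed (Vertex.shift_injective n m j e)) (h _ _ (hd₀.shift j)) h1 h2
    exact Curve.toArc_eq_iff.2 ⟨j, h3⟩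
  exact ⟨c, hT.2 hins (Set.subset_insert _ _) (Set.mem_insert _ _), rfl, rfl⟩

end edge

/-! ## Friezes from positive supersolutions -/

/-- The solution of the recursion with the coefficients `a` that is `0, 1` in the positions
`i - 2, i - 1`. -/
def continuant (a : ℤ → ℤ) (i : ℤ) : ℕ → ℤ
  | 0 => 0
  | 1 => 1
  | k + 2 => a (i + k) * continuant a i (k + 1) - continuant a i k

/-- This is the Casoratian of two solutions of the same recursion, hence independent of `k`. -/
theorem continuant_det (a : ℤ → ℤ) (i : ℤ) (k : ℕ) :
    continuant a i (k + 1) * continuant a (i + 1) (k + 1) -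
      continuant a (i + 1) k * continuant a i (k + 2) = 1 := by
  induction k with
  | zero => simp [continuant]
  | succ k ih =>
    have e : i + 1 + (k : ℤ) = i + ((k + 1 : ℕ) : ℤ) := by push_cast; ring
    rw [show continuant a i (k + 1 + 2) = a (i + ((k + 1 : ℕ) : ℤ)) * continuant a i (k + 2) -
      continuant a i (k + 1) from rfl, show continuant a (i + 1) (k + 1 + 1) =
      a (i + 1 + (k : ℤ)) * continuant a (i + 1) (k + 1) - continuant a (i + 1) k from rfl, e]
    linear_combination ih

/-- Sturm comparison: the Casoratian with `w` in `key` starts at `w (i - 1)` and does not decrease,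
because `w` is a supersolution. So the ratio of `continuant a i (k + 1)` to `w (i + k)` grows from
the value `0` before the first step. -/
theorem continuant_pos {a w : ℤ → ℤ} (hw : ∀ p, 0 < w p)
    (h : ∀ p, w (p - 1) + w (p + 1) ≤ a p * w p) (i : ℤ) (k : ℕ) :
    0 < continuant a i (k + 1) := by
  have key : ∀ k : ℕ, 0 < continuant a i (k + 1) ∧
      0 < continuant a i (k + 1) * w (i + k - 1) - continuant a i k * w (i + k) := by
    intro k
    induction k with
    | zero => simpa [continuant] using hw (i - 1)
    | succ k ih =>
      have hk := h (i + k)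
      have h1 : 0 < continuant a i (k + 2) * w (i + k) -
          continuant a i (k + 1) * w (i + k + 1) := by
        rw [show continuant a i (k + 2) = a (i + k) * continuant a i (k + 1) - continuant a i k
          from rfl]
        nlinarith [mul_le_mul_of_nonneg_left hk ih.1.le]
      have e1 : i + ((k + 1 : ℕ) : ℤ) - 1 = i + k := by push_cast; ring
      have e2 : i + ((k + 1 : ℕ) : ℤ) = i + k + 1 := by push_cast; ring
      rw [e1, e2]
      refine ⟨?_, h1⟩
      have h2 : 0 < continuant a i (k + 2) * w (i + k) := by
        have := mul_pos ih.1 (hw (i + k + 1))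
        linarith
      exact pos_of_mul_pos_left h2 (hw _).le
  exact (key k).1

/-- A sequence `a` is the quiddity sequence of an infinite frieze if the difference equation with
the coefficients `a` has a positive supersolution. -/
theorem exists_isInfiniteFrieze {a w : ℤ → ℤ} (hw : ∀ p, 0 < w p)
    (h : ∀ p, w (p - 1) + w (p + 1) ≤ a p * w p) :
    ∃ F : ℤ → ℤ → ℤ, IsInfiniteFrieze F ∧ ∀ i, F i i = a i := by
  -- The offset `2` puts the zero of the continuant at `j = i - 2`; the truncation of `toNat`
  -- affects only entries further left, which are irrelevant.
  refine ⟨fun i j => continuant a i (j - i + 2).toNat, ⟨fun i => ?_, fun i => ?_, fun i j hij => ?_,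
    fun i j hij => ?_⟩, fun i => ?_⟩
  · simp [continuant]
  · simp only [show i - 1 - i + 2 = 1 by ring]
    simp [continuant]
  · obtain ⟨k, rfl⟩ := Int.le.dest hij
    simp only [show i + (k : ℤ) - i + 2 = ((k + 1 + 1 : ℕ) : ℤ) by push_cast; ring, Int.toNat_natCast]
    exact continuant_pos hw h i (k + 1)
  · obtain ⟨k, hk⟩ := Int.le.dest hij
    obtain rfl : j = i - 1 + k := hk.symm
    simp only [show i - 1 + (k : ℤ) - i + 2 = ((k + 1 : ℕ) : ℤ) by push_cast; ring,
      show i - 1 + (k : ℤ) + 1 - (i + 1) + 2 = ((k + 1 : ℕ) : ℤ) by push_cast; ring,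
      show i - 1 + (k : ℤ) - (i + 1) + 2 = (k : ℤ) by ring,
      show i - 1 + (k : ℤ) + 1 - i + 2 = ((k + 2 : ℕ) : ℤ) by push_cast; ring, Int.toNat_natCast]
    exact continuant_det a i k
  · simp [continuant]

/-! ## Systems of peripheral arcs -/

/-- A system of pairwise noncrossing arcs of bounded length between integers, given by their ends
`i < j`, that contains the segments `(i, i + 1)` and has a triangle below each of the other arcs. -/
structure IsPeripheralSystem (N : ℤ) (J : ℤ → ℤ → Prop) : Prop where
  lt : ∀ {i j}, J i j → i < j
  le_add : ∀ {i j}, J i j → j ≤ i + N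
  segment : ∀ i, J i (i + 1)
  noncrossing : ∀ {i j k l}, J i j → J k l → i < k → k < j → l ≤ j
  exists_triangle : ∀ {i j}, J i j → i + 1 < j → ∃ r, J i r ∧ J r j

namespace IsPeripheralSystem

variable {N : ℤ} {J : ℤ → ℤ → Prop}

/-- The arcs that pass over `p`. -/
def covers (J : ℤ → ℤ → Prop) (p : ℤ) : Set (ℤ × ℤ) := {e | J e.1 e.2 ∧ e.1 < p ∧ p < e.2}

theorem finite_covers (h : IsPeripheralSystem N J) (p : ℤ) : (covers J p).Finite := by
  refine (Set.finite_Icc ((p - N, p - N) : ℤ × ℤ) (p + N, p + N)).subset ?_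
  rintro ⟨i, j⟩ ⟨h1, h2, h3⟩
  have := h.le_add h1
  simp only at *
  refine ⟨⟨?_, ?_⟩, ?_, ?_⟩ <;> simp only <;> omega

/-- The reflection of a system of peripheral arcs. -/
theorem neg (h : IsPeripheralSystem N J) : IsPeripheralSystem N fun i j => J (-j) (-i) where
  lt hij := by have := h.lt hij; omega
  le_add hij := by have := h.le_add hij; omega
  segment i := by
    have := h.segment (-(i + 1))
    rwa [show -(i + 1) + 1 = -i by ring] at this
  noncrossing hij hkl h1 h2 := by
    by_contra! h3
    have := h.noncrossing hkl hij (by omega) (by omega)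
    omega
  exists_triangle hij h1 := by
    obtain ⟨r, hr, hr'⟩ := h.exists_triangle hij (by omega)
    exact ⟨-r, by rwa [neg_neg], by rwa [neg_neg]⟩

/-- Descent: of the triangle below an arc over `p`, either `p` is the third vertex or one of the two
shorter sides still passes over `p`. -/
theorem exists_apex (h : IsPeripheralSystem N J) {p i j : ℤ} (hij : J i j) (hi : i < p)
    (hj : p < j) : ∃ i j, J i p ∧ J p j ∧ J i j := by
  induction hk : (j - i).toNat using Nat.strong_induction_on generalizing i j with
  | _ k ih =>
    obtain ⟨r, hr, hr'⟩ := h.exists_triangle hij (by omega)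
    have h1 := h.lt hr
    have h2 := h.lt hr'
    rcases lt_trichotomy r p with hp | rfl | hp
    · exact ih (j - r).toNat (by omega) hr' hp hj rfl
    · exact ⟨i, j, hr, hr', hij⟩
    · exact ih (r - i).toNat (by omega) hr hi hp rfl

/-- Otherwise the upper side of one triangle would cross a side at `p` of the other. This makes the
choice in `weight` irrelevant. -/
theorem apex_unique (h : IsPeripheralSystem N J) {p i j i' j' : ℤ} (h1 : J i p) (h2 : J p j)
    (h3 : J i j) (h1' : J i' p) (h2' : J p j') (h3' : J i' j') : i = i' ∧ j = j' := by
  have := h.lt h1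
  have := h.lt h2
  have := h.lt h1'
  have := h.lt h2'
  refine ⟨?_, le_antisymm (h.noncrossing h3' h2 ‹_› ‹_›) (h.noncrossing h3 h2' ‹_› ‹_›)⟩
  rcases lt_trichotomy i i' with hi | hi | hi
  · have := h.noncrossing h1 h3' hi ‹_›; omega
  · exact hi
  · have := h.noncrossing h1' h3 hi ‹_›; omega

/-- This makes the recursion for `weight` terminate: an arc over `i` cannot cross `(i, j)` and so
passes over `p` too, while `(i, j)` passes over `p` but not over `i`. -/
theorem covers_left_ssubset (h : IsPeripheralSystem N J) {p i j : ℤ} (h1 : J i p) (h2 : J p j)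
    (h3 : J i j) : covers J i ⊂ covers J p := by
  have hi := h.lt h1
  have hj := h.lt h2
  refine (Set.ssubset_iff_of_subset ?_).2 ⟨(i, j), ⟨h3, hi, hj⟩, fun h' => h'.2.1.false⟩
  rintro ⟨k, l⟩ ⟨hkl, hk, hl⟩
  exact ⟨hkl, hk.trans hi, hj.trans_le (h.noncrossing hkl h3 hk hl)⟩

theorem covers_right_ssubset (h : IsPeripheralSystem N J) {p i j : ℤ} (h1 : J i p) (h2 : J p j)
    (h3 : J i j) : covers J j ⊂ covers J p := by
  have hi := h.lt h1
  have hj := h.lt h2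
  refine (Set.ssubset_iff_of_subset ?_).2 ⟨(i, j), ⟨h3, hi, hj⟩, fun h' => h'.2.2.false⟩
  rintro ⟨k, l⟩ ⟨hkl, hk, hl⟩
  refine ⟨hkl, ?_, hj.trans hl⟩
  simp only at hk hl hkl ⊢
  rcases lt_trichotomy k p with hp | rfl | hp
  · exact hp
  · exact absurd (h.noncrossing h3 hkl hi hj) hl.not_ge
  · exact absurd (h.noncrossing h2 hkl hp hk) hl.not_ge

open Classical in
/-- The weight of an integer is `1` if no arc passes over it, and otherwise it is the sum of the
weights of the ends of the shortest arc that passes over it. -/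
def weight (h : IsPeripheralSystem N J) (p : ℤ) : ℤ :=
  if hp : ∃ e : ℤ × ℤ, J e.1 p ∧ J p e.2 ∧ J e.1 e.2 then
    weight h hp.choose.1 + weight h hp.choose.2
  else 1
termination_by (covers J p).ncard
decreasing_by
  · exact Set.ncard_lt_ncard (h.covers_left_ssubset hp.choose_spec.1 hp.choose_spec.2.1
      hp.choose_spec.2.2) (h.finite_covers p)
  · exact Set.ncard_lt_ncard (h.covers_right_ssubset hp.choose_spec.1 hp.choose_spec.2.1
      hp.choose_spec.2.2) (h.finite_covers p)

theorem weight_apex (h : IsPeripheralSystem N J) {p i j : ℤ} (h1 : J i p) (h2 : J p j)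
    (h3 : J i j) : h.weight p = h.weight i + h.weight j := by
  have hp : ∃ e : ℤ × ℤ, J e.1 p ∧ J p e.2 ∧ J e.1 e.2 := ⟨(i, j), h1, h2, h3⟩
  obtain ⟨e1, e2⟩ := h.apex_unique h1 h2 h3 hp.choose_spec.1 hp.choose_spec.2.1 hp.choose_spec.2.2
  rw [weight, dif_pos hp, e1, e2]

theorem weight_of_covers_eq_empty (h : IsPeripheralSystem N J) {p : ℤ} (hp : covers J p = ∅) :
    h.weight p = 1 := by
  rw [weight, dif_neg]
  rintro ⟨e, h1, h2, h3⟩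
  exact (Set.eq_empty_iff_forall_notMem.1 hp e) ⟨h3, h.lt h1, h.lt h2⟩

theorem weight_pos (h : IsPeripheralSystem N J) (p : ℤ) : 0 < h.weight p := by
  fun_induction weight h p with
  | case1 p hp ih1 ih2 => exact add_pos ih1 ih2
  | case2 p hp => exact one_pos

/-- The fan of triangles at `p` over the arcs that end in `p`. -/
theorem exists_left_fan (h : IsPeripheralSystem N J) {w : ℤ → ℤ}
    (hw : ∀ i p j, J i p → J p j → J i j → w p = w i + w j) (p : ℤ) :
    ∃ (l : ℤ) (S : Finset ℤ) (f : ℤ → ℤ), J l p ∧ (∀ k, J k p → l ≤ k) ∧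
      (∀ x ∈ S, J (f x) x ∧ J (f x) p ∧ J x p) ∧ w (p - 1) = w l + S.card * w p := by
  -- `S` collects the middle vertices `r` of the triangles `(l, r, p)` met on descending from the
  -- arc `(l, p)` to the segment at `p`, with `f r = l`. Each contributes `w r = w l + w p`, and
  -- these equations telescope.
  have key : ∀ l, J l p → ∃ (S : Finset ℤ) (f : ℤ → ℤ),
      (∀ x ∈ S, l < x ∧ J (f x) x ∧ J (f x) p ∧ J x p) ∧ w (p - 1) = w l + S.card * w p := by
    intro l hl
    induction hk : (p - l).toNat using Nat.strong_induction_on generalizing l with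
    | _ k ih =>
      have hlp := h.lt hl
      rcases (show l + 1 ≤ p by omega).eq_or_lt with hp | hp
      · exact ⟨∅, id, by simp, by simp [← hp]⟩
      · obtain ⟨r, hr, hr'⟩ := h.exists_triangle hl hp
        have h1 := h.lt hr
        have h2 := h.lt hr'
        obtain ⟨S, f, hS, hS'⟩ := ih (p - r).toNat (by omega) r hr' rfl
        have hrS : r ∉ S := fun h' => (hS r h').1.false
        refine ⟨insert r S, Function.update f r l, fun x hx => ?_, ?_⟩
        · rcases Finset.mem_insert.1 hx with rfl | hx'
          · simpa using ⟨h1, hr, hl, hr'⟩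
          · have hxr : x ≠ r := by rintro rfl; exact hrS hx'
            rw [Function.update_of_ne hxr]
            exact ⟨h1.trans (hS x hx').1, (hS x hx').2⟩
        · rw [Finset.card_insert_of_notMem hrS, hS', hw l r p hr hr' hl]
          push_cast
          ring
  obtain ⟨l, hl, hl'⟩ : ∃ l, J l p ∧ ∀ k, J k p → l ≤ k := by
    obtain ⟨l, hl, hl'⟩ := Int.exists_least_of_bdd (P := fun l => J l p)
      ⟨p - N, fun z hz => by have := h.le_add hz; omega⟩
      ⟨p - 1, by simpa using h.segment (p - 1)⟩
    exact ⟨l, hl, hl'⟩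
  obtain ⟨S, f, hS, hS'⟩ := key l hl
  exact ⟨l, S, f, hl, hl', fun x hx => (hS x hx).2, hS'⟩

/-- The fan of triangles at `p` over the arcs that start in `p`. -/
theorem exists_right_fan (h : IsPeripheralSystem N J) {w : ℤ → ℤ}
    (hw : ∀ i p j, J i p → J p j → J i j → w p = w i + w j) (p : ℤ) :
    ∃ (r : ℤ) (S : Finset ℤ) (f : ℤ → ℤ), J p r ∧ (∀ k, J p k → k ≤ r) ∧
      (∀ x ∈ S, J x (f x) ∧ J p (f x) ∧ J p x) ∧ w (p + 1) = w r + S.card * w p := by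
  obtain ⟨l, S, f, hl, hl', hS, hS'⟩ := h.neg.exists_left_fan (w := fun i => w (-i))
    (fun i p j h1 h2 h3 => by rw [hw _ _ _ h2 h1 h3, add_comm]) (-p)
  refine ⟨-l, S.map (Equiv.neg ℤ).toEmbedding, fun x => -f (-x), ?_, fun k hk => ?_, fun x hx => ?_,
    ?_⟩
  · simpa using hl
  · have := hl' (-k) (by simpa using hk)
    omega
  · obtain ⟨y, hy, rfl⟩ := Finset.mem_map.1 hx
    simpa using hS y hy
  · simpa [add_comm] using hS'

/-- The weights around `p`. The fans at `p` end in `l` and `r`; either the arc `(l, r)` closes them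
to a polygon, or no arc passes over `p`, `l` and `r`. -/
theorem exists_fans (h : IsPeripheralSystem N J) (p : ℤ) :
    ∃ (l r : ℤ) (S R : Finset ℤ) (f g : ℤ → ℤ), J l p ∧ J p r ∧
      (∀ x ∈ S, J (f x) x ∧ J (f x) p ∧ J x p) ∧ (∀ x ∈ R, J x (g x) ∧ J p (g x) ∧ J p x) ∧
      ((J l r ∧ h.weight (p - 1) + h.weight (p + 1) = (S.card + R.card + 1) * h.weight p) ∨
        ((covers J p = ∅ ∧ covers J l = ∅ ∧ covers J r = ∅) ∧
          h.weight (p - 1) + h.weight (p + 1) = (S.card + R.card + 2) * h.weight p)) := by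
  obtain ⟨l, S, f, hl, hl', hS, hS'⟩ := h.exists_left_fan
    (fun i p j h1 h2 h3 => h.weight_apex h1 h2 h3) p
  obtain ⟨r, R, g, hr, hr', hR, hR'⟩ := h.exists_right_fan
    (fun i p j h1 h2 h3 => h.weight_apex h1 h2 h3) p
  refine ⟨l, r, S, R, f, g, hl, hr, hS, hR, ?_⟩
  have hlp := h.lt hl
  have hrp := h.lt hr
  by_cases hp : covers J p = ∅
  · right
    have hl0 : covers J l = ∅ := by
      refine Set.eq_empty_iff_forall_notMem.2 ?_
      rintro ⟨i, j⟩ ⟨hij, hi, hj⟩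
      rcases (h.noncrossing hij hl hi hj).eq_or_lt with rfl | hj'
      · exact (hl' i hij).not_gt hi
      · exact Set.eq_empty_iff_forall_notMem.1 hp (i, j) ⟨hij, hi.trans hlp, hj'⟩
    have hr0 : covers J r = ∅ := by
      refine Set.eq_empty_iff_forall_notMem.2 ?_
      rintro ⟨i, j⟩ ⟨hij, hi, hj⟩
      simp only at hij hi hj
      rcases lt_trichotomy i p with hip | rfl | hip
      · exact Set.eq_empty_iff_forall_notMem.1 hp (i, j) ⟨hij, hip, hrp.trans hj⟩
      · exact (hr' j hij).not_gt hj
      · exact (h.noncrossing hr hij hip hi).not_gt hj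
    -- All three weights are `1`, so `w l + w r` is twice `w p`.
    refine ⟨⟨hp, hl0, hr0⟩, ?_⟩
    rw [hS', hR', h.weight_of_covers_eq_empty hp, h.weight_of_covers_eq_empty hl0,
      h.weight_of_covers_eq_empty hr0]
    ring
  · left
    obtain ⟨⟨i, j⟩, hij, hi, hj⟩ := Set.nonempty_iff_ne_empty.2 hp
    -- Arcs at `p` longer than `(i, p)` or `(p, j)` would cross `(i, j)`, so the fans end exactly at
    -- `i` and `j`.
    obtain ⟨i, j, h1, h2, h3⟩ := h.exists_apex hij hi hj
    have hi := h.lt h1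
    have hj := h.lt h2
    obtain rfl : l = i := by
      refine (hl' i h1).antisymm (not_lt.1 fun hli => ?_)
      exact (h.noncrossing hl h3 hli hi).not_gt hj
    obtain rfl : r = j := (h.noncrossing h3 hr hi hj).antisymm (hr' j h2)
    refine ⟨h3, ?_⟩
    rw [hS', hR', add_mul, h.weight_apex h1 h2 h3]
    ring

end IsPeripheralSystem

/-! ## The sides of a pair of vertices -/

/-- The pair `u`, `v` separates two vertices if and only if this has different signs for them. -/
def side (n m : ℕ) (u v x : Vertex) : ℝ := bracket n m u x * bracket n m v x

section side

variable {n m : ℕ}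

theorem crossing_eq_side (u v x y : Vertex) :
    crossing n m u v x y = side n m u v x * side n m u v y := by
  unfold crossing side; ring

theorem side_left (u v : Vertex) : side n m u v u = 0 := by simp [side, bracket_self]

theorem side_right (u v : Vertex) : side n m u v v = 0 := by simp [side, bracket_self]

theorem bracket_lower_lower_neg {k l : ℤ} (h : k < l) : bracket n m (.lower k) (.lower l) < 0 := by
  rw [bracket_swap]; exact neg_neg_of_pos (bracket_lower_lower_pos h)

theorem bracket_upper_lower_neg (k l : ℤ) : bracket n m (.upper k) (.lower l) < 0 := by
  rw [bracket_swap]; exact neg_neg_of_pos (bracket_lower_upper_pos l k)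

theorem bracket_upper_negInf_neg (k : ℤ) : bracket n m (.upper k) .negInf < 0 := by
  rw [bracket_swap]; exact neg_neg_of_pos (bracket_negInf_upper_pos k)

theorem bracket_negInf_lower_neg (k : ℤ) : bracket n m .negInf (.lower k) < 0 := by
  rw [bracket_swap]; exact neg_neg_of_pos (bracket_lower_negInf_pos k)

theorem bracket_posInf_neg {u : Vertex} (h : u ≠ .posInf) : bracket n m u .posInf < 0 := by
  rw [bracket_swap]; exact neg_neg_of_pos (bracket_posInf_pos h)

theorem bracket_upper_upper_neg (hn : 0 < n) {k l : ℤ} (h : l < k) :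
    bracket n m (.upper k) (.upper l) < 0 := by
  rw [bracket_swap]; exact neg_neg_of_pos (bracket_upper_upper_pos hn h)

theorem side_lower_lower_neg {i j k : ℤ} (h : i < k) (h' : k < j) :
    side n m (.lower i) (.lower j) (.lower k) < 0 :=
  mul_neg_of_neg_of_pos (bracket_lower_lower_neg h) (bracket_lower_lower_pos h')

/-- The vertex `x` does not lie in the closed interval `[i, j]` of the lower boundary. -/
def IsOutside (i j : ℤ) (x : Vertex) : Prop := ∀ k, x = .lower k → k < i ∨ j < k

theorem side_lower_lower_pos {i j : ℤ} {x : Vertex} (hij : i < j) (h : IsOutside i j x) :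
    0 < side n m (.lower i) (.lower j) x := by
  cases x with
  | lower k =>
    rcases h k rfl with h | h
    · exact mul_pos (bracket_lower_lower_pos h) (bracket_lower_lower_pos (h.trans hij))
    · exact mul_pos_of_neg_of_neg (bracket_lower_lower_neg (hij.trans h))
        (bracket_lower_lower_neg h)
  | upper k => exact mul_pos (bracket_lower_upper_pos _ _) (bracket_lower_upper_pos _ _)
  | posInf =>
    exact mul_pos_of_neg_of_neg (bracket_posInf_neg (by simp)) (bracket_posInf_neg (by simp))
  | negInf => exact mul_pos (bracket_lower_negInf_pos _) (bracket_lower_negInf_pos _)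

theorem exists_of_side_lower_lower_neg {i j : ℤ} {x : Vertex} (hij : i < j)
    (h : side n m (.lower i) (.lower j) x < 0) : ∃ k, x = .lower k ∧ i < k ∧ k < j := by
  have h1 : ¬ IsOutside i j x := fun h' => (side_lower_lower_pos hij h').not_gt h
  simp only [IsOutside, not_forall, not_or, not_lt] at h1
  obtain ⟨k, rfl, h2, h3⟩ := h1
  refine ⟨k, rfl, h2.lt_of_ne ?_, h3.lt_of_ne ?_⟩
  · rintro rfl; rw [side_left] at h; exact h.false
  · rintro rfl; rw [side_right] at h; exact h.false

/-- The vertex `x` lies to the right of the pair `lower i`, `upper k`. -/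
def IsRightOf (i k : ℤ) : Vertex → Prop
  | .lower j => i < j
  | .upper l => k < l
  | .posInf => True
  | .negInf => False

/-- The vertex `x` lies to the left of the pair `lower i`, `upper k`. -/
def IsLeftOf (i k : ℤ) : Vertex → Prop
  | .lower j => j < i
  | .upper l => l < k
  | .posInf => False
  | .negInf => True

theorem side_lower_upper_pos (hn : 0 < n) {i k : ℤ} {x : Vertex} (h : IsRightOf i k x) :
    0 < side n m (.lower i) (.upper k) x := by
  cases x with
  | lower j => exact mul_pos_of_neg_of_neg (bracket_lower_lower_neg h) (bracket_upper_lower_neg _ _)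
  | upper l => exact mul_pos (bracket_lower_upper_pos _ _) (bracket_upper_upper_pos hn h)
  | posInf =>
    exact mul_pos_of_neg_of_neg (bracket_posInf_neg (by simp)) (bracket_posInf_neg (by simp))
  | negInf => exact h.elim

theorem side_lower_upper_neg (hn : 0 < n) {i k : ℤ} {x : Vertex} (h : IsLeftOf i k x) :
    side n m (.lower i) (.upper k) x < 0 := by
  cases x with
  | lower j => exact mul_neg_of_pos_of_neg (bracket_lower_lower_pos h) (bracket_upper_lower_neg _ _)
  | upper l => exact mul_neg_of_pos_of_neg (bracket_lower_upper_pos _ _) (bracket_upper_upper_neg hn h)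
  | posInf => exact h.elim
  | negInf => exact mul_neg_of_pos_of_neg (bracket_lower_negInf_pos _) (bracket_upper_negInf_neg _)

theorem isRightOf_of_side_pos (hn : 0 < n) {i k : ℤ} {x : Vertex}
    (h : 0 < side n m (.lower i) (.upper k) x) : IsRightOf i k x := by
  by_contra h'
  have h1 : ¬ IsLeftOf i k x := fun h1 => (side_lower_upper_neg hn h1).not_gt h
  cases x with
  | lower j =>
    obtain rfl : i = j := le_antisymm (not_lt.1 h1) (not_lt.1 h')
    rw [side_left] at h; exact h.false
  | upper l =>
    obtain rfl : k = l := le_antisymm (not_lt.1 h1) (not_lt.1 h')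
    rw [side_right] at h; exact h.false
  | posInf => exact h' trivial
  | negInf => exact h1 trivial

theorem isLeftOf_of_side_neg (hn : 0 < n) {i k : ℤ} {x : Vertex}
    (h : side n m (.lower i) (.upper k) x < 0) : IsLeftOf i k x := by
  by_contra h'
  have h1 : ¬ IsRightOf i k x := fun h1 => (side_lower_upper_pos hn h1).not_gt h
  cases x with
  | lower j =>
    obtain rfl : i = j := le_antisymm (not_lt.1 h') (not_lt.1 h1)
    rw [side_left] at h; exact h.false
  | upper l =>
    obtain rfl : k = l := le_antisymm (not_lt.1 h') (not_lt.1 h1)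
    rw [side_right] at h; exact h.false
  | posInf => exact h1 trivial
  | negInf => exact h' trivial

theorem side_lower_posInf_neg {i k : ℤ} (h : i < k) :
    side n m (.lower i) .posInf (.lower k) < 0 :=
  mul_neg_of_neg_of_pos (bracket_lower_lower_neg h) (bracket_posInf_pos (by simp))

theorem side_lower_posInf_pos {i : ℤ} {x : Vertex} (hx : x ≠ .posInf)
    (h : ∀ k, x = .lower k → k < i) : 0 < side n m (.lower i) .posInf x := by
  refine mul_pos ?_ (bracket_posInf_pos hx)
  cases x with
  | lower k => exact bracket_lower_lower_pos (h k rfl)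
  | upper k => exact bracket_lower_upper_pos _ _
  | posInf => exact absurd rfl hx
  | negInf => exact bracket_lower_negInf_pos _

theorem side_lower_negInf_neg {i k : ℤ} (h : k < i) :
    side n m (.lower i) .negInf (.lower k) < 0 :=
  mul_neg_of_pos_of_neg (bracket_lower_lower_pos h) (bracket_negInf_lower_neg _)

theorem side_lower_negInf_pos {i : ℤ} {x : Vertex} (hx : x ≠ .negInf)
    (h : ∀ k, x = .lower k → i < k) : 0 < side n m (.lower i) .negInf x := by
  cases x with
  | lower k => exact mul_pos_of_neg_of_neg (bracket_lower_lower_neg (h k rfl)) (bracket_negInf_lower_neg _)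
  | upper k => exact mul_pos (bracket_lower_upper_pos _ _) (bracket_negInf_upper_pos _)
  | posInf => exact mul_pos_of_neg_of_neg (bracket_posInf_neg (by simp)) (bracket_posInf_neg (by simp))
  | negInf => exact absurd rfl hx

end side

/-! ## The edges of a triangulation around the lower boundary -/

section lower

variable {n m : ℕ} {T : Set (Arc n m)}

theorem exists_mul_lt (hn : 0 < n) (i a : ℤ) : ∃ j : ℤ, i + j * n < a :=
  ⟨-(|i| + |a| + 1), by
    have h1 := le_abs_self i
    have h2 := neg_abs_le a
    have h3 : (1 : ℤ) ≤ n := by exact_mod_cast hn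
    nlinarith [abs_nonneg i, abs_nonneg a]⟩

theorem exists_lt_mul (hn : 0 < n) (i a : ℤ) : ∃ j : ℤ, a < i + j * n :=
  ⟨|i| + |a| + 1, by
    have h1 := neg_abs_le i
    have h2 := le_abs_self a
    have h3 : (1 : ℤ) ≤ n := by exact_mod_cast hn
    nlinarith [abs_nonneg i, abs_nonneg a]⟩

theorem Edge.not_separate (hn : 0 < n) (hT : IsTriangulation T) {u v x y : Vertex}
    (h : Edge T u v) (h' : Edge T x y) (hx : side n m u v x < 0) (hy : 0 < side n m u v y) :
    False := by
  have := h.crossing_nonneg hn hT h'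
  rw [crossing_eq_side] at this
  exact this.not_gt (mul_neg_of_neg_of_pos hx hy)

/-- To show that a pair of vertices is an edge of a triangulation it suffices that no edge has ends
on different sides. -/
theorem edge_of_not_separate (hn : 0 < n) (hT : IsTriangulation T) {u v : Vertex}
    (huv : IsArcPair m u v) (hself : ∀ j, 0 ≤ crossing n m u v (u.shift n m j) (v.shift n m j))
    (h : ∀ x y, Edge T x y → side n m u v x < 0 → 0 < side n m u v y → False) : Edge T u v := by
  refine edge_of_crossing_nonneg hn hT huv hself fun x y hxy => ?_
  rw [crossing_eq_side]
  by_contra! hneg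
  rcases mul_neg_iff.1 hneg with ⟨h1, h2⟩ | ⟨h1, h2⟩
  · exact h y x hxy.symm h2 h1
  · exact h x y hxy h1 h2

theorem Edge.exists_lower (hn : 0 < n) (hT : IsTriangulation T) {i j k : ℤ} {y : Vertex}
    (h : Edge T (.lower i) (.lower j)) (h' : Edge T (.lower k) y) (hi : i < k) (hj : k < j) :
    ∃ l, y = .lower l ∧ i ≤ l ∧ l ≤ j := by
  by_contra! h0
  refine h.not_separate hn hT h' (side_lower_lower_neg hi hj)
    (side_lower_lower_pos (hi.trans hj) fun l hl => ?_)
  have := h0 l hl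
  omega

/-- The system of peripheral arcs of a triangulation, and of boundary segments, at the lower
boundary. -/
def LowerJoined (T : Set (Arc n m)) (i j : ℤ) : Prop := i < j ∧ Joined T (.lower i) (.lower j)

theorem joined_comm {u v : Vertex} : Joined T u v ↔ Joined T v u :=
  or_congr boundarySegment_comm edge_comm

theorem LowerJoined.eq_or_edge {i j : ℤ} (h : LowerJoined T i j) :
    j = i + 1 ∨ Edge T (.lower i) (.lower j) := by
  rcases h.2 with h' | h'
  · left
    have h1 := h.1
    have : j = i + 1 ∨ i = j + 1 := h'
    omega
  · exact Or.inr h'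

theorem lowerJoined_of_edge {i j : ℤ} (hij : i < j) (h : Edge T (.lower i) (.lower j)) :
    LowerJoined T i j := ⟨hij, Or.inr h⟩

theorem lowerJoined_succ (i : ℤ) : LowerJoined T i (i + 1) := ⟨by omega, Or.inl (Or.inl rfl)⟩

theorem LowerJoined.exists_lower (hn : 0 < n) (hT : IsTriangulation T) {i j k : ℤ} {y : Vertex}
    (h : LowerJoined T i j) (h' : Edge T (.lower k) y) (hi : i < k) (hj : k < j) :
    ∃ l, y = .lower l ∧ i ≤ l ∧ l ≤ j := by
  rcases h.eq_or_edge with h | h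
  · omega
  · exact h.exists_lower hn hT h' hi hj

/-- An arc longer than one period would cross its own translate, and the triangles below arcs come
from maximality. -/
theorem isPeripheralSystem (hn : 0 < n) (hT : IsTriangulation T) :
    IsPeripheralSystem n (LowerJoined T) where
  lt h := h.1
  le_add {i j} h := by
    rcases h.eq_or_edge with h | h
    · omega
    · by_contra! hj
      have h' : Edge T (.lower (i + n)) (.lower (j + n)) := by
        simpa [Vertex.shift] using h.shift 1
      obtain ⟨l, hl, -, hl'⟩ := h.exists_lower hn hT h' (by omega) hj
      simp only [Vertex.lower.injEq] at hl
      omega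
  segment := lowerJoined_succ
  noncrossing {i j k l} h h' hik hkj := by
    rcases h'.eq_or_edge with h1 | h1
    · omega
    · obtain ⟨l', hl, -, hl'⟩ := h.exists_lower hn hT h1 hik hkj
      simp only [Vertex.lower.injEq] at hl
      omega
  exists_triangle {i j} h hij := by
    have hE : Edge T (.lower i) (.lower j) := h.eq_or_edge.resolve_left (by omega)
    have hle : j ≤ i + n := by
      by_contra! hj
      have h' : Edge T (.lower (i + n)) (.lower (j + n)) := by
        simpa [Vertex.shift] using hE.shift 1
      obtain ⟨l, hl, -, hl'⟩ := hE.exists_lower hn hT h' (by omega) hj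
      simp only [Vertex.lower.injEq] at hl
      omega
    -- The third vertex is the farthest neighbour `r` of `i` before `j`. An edge crossing `(r, j)`
    -- would cross `(i, j)` or `(i, r)`, or end in `i` and contradict the choice of `r`.
    obtain ⟨r, ⟨hr, hrj⟩, hmax⟩ := Int.exists_greatest_of_bdd
      (P := fun r => LowerJoined T i r ∧ r < j) ⟨j, fun z hz => hz.2.le⟩
      ⟨i + 1, lowerJoined_succ i, hij⟩
    refine ⟨r, hr, ?_⟩
    have hir := hr.1
    rcases (show r + 1 ≤ j by omega).eq_or_lt with rfl | hrj'
    · exact lowerJoined_succ r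
    refine lowerJoined_of_edge hrj (edge_of_not_separate hn hT
      ⟨Or.inl ⟨trivial, trivial⟩, by simp; omega, by simp [BoundarySegment]; omega⟩ ?_ ?_)
    · intro a
      have hnonneg : ∀ k : ℤ, k ≤ r ∨ j ≤ k → 0 ≤ side n m (.lower r) (.lower j) (.lower k) := by
        intro k hk
        by_contra! h0
        obtain ⟨l, hl, h1, h2⟩ := exists_of_side_lower_lower_neg hrj h0
        simp only [Vertex.lower.injEq] at hl
        omega
      rw [crossing_eq_side]
      rcases lt_trichotomy a 0 with ha | rfl | ha
      · have : a * n ≤ -n := by nlinarith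
        exact mul_nonneg (hnonneg _ (by omega)) (hnonneg _ (by omega))
      · simp [Vertex.shift_zero, side_left]
      · have : n ≤ a * n := by nlinarith
        exact mul_nonneg (hnonneg _ (by omega)) (hnonneg _ (by omega))
    · intro x y hxy hx hy
      obtain ⟨k, rfl, hk, hk'⟩ := exists_of_side_lower_lower_neg hrj hx
      obtain ⟨l, rfl, hl, hl'⟩ := hE.exists_lower hn hT hxy (by omega) hk'
      rcases lt_or_ge l r with hlr | hlr
      · rcases hl.eq_or_lt with rfl | hil
        · exact (hmax k ⟨lowerJoined_of_edge (by omega) hxy.symm, hk'⟩).not_gt hk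
        · obtain ⟨k', hk1, -, hk2⟩ := hr.exists_lower hn hT hxy.symm hil hlr
          simp only [Vertex.lower.injEq] at hk1
          omega
      · rcases hlr.eq_or_lt with rfl | hrl
        · rw [side_left] at hy; exact hy.false
        rcases hl'.eq_or_lt with rfl | hlj
        · rw [side_right] at hy; exact hy.false
        · exact hy.not_gt (side_lower_lower_neg hrl hlj)

open IsPeripheralSystem

theorem not_lower_edge_of_covers_eq_empty {p i j : ℤ} (hp : covers (LowerJoined T) p = ∅)
    (h : Edge T (.lower i) (.lower j)) (hi : i < p) (hj : p < j) : False :=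
  Set.eq_empty_iff_forall_notMem.1 hp (i, j) ⟨lowerJoined_of_edge (hi.trans hj) h, hi, hj⟩

theorem Edge.marked_right {u : Vertex} {k : ℤ} (h : Edge T u (.upper k)) : m ≠ 0 := by
  simpa [Vertex.IsMarked, Vertex.IsInfinite] using h.isArcPair.valid_right

/-- Bridging arcs are ordered. -/
theorem Edge.upper_le_upper (hn : 0 < n) (hT : IsTriangulation T) {i j k l : ℤ}
    (h : Edge T (.lower i) (.upper k)) (h' : Edge T (.lower j) (.upper l)) (hij : i < j) :
    k ≤ l := by
  by_contra! hlk
  exact h.not_separate hn hT h'.symm (side_lower_upper_neg hn (by exact hlk))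
    (side_lower_upper_pos hn (by exact hij))

/-- A triangulation with bridging arcs has no asymptotic arcs. -/
theorem Edge.not_posInf (hn : 0 < n) (hT : IsTriangulation T) {i k : ℤ} {u : Vertex}
    (h : Edge T (.lower i) (.upper k)) (h' : Edge T u .posInf) : False := by
  have hm := Nat.pos_of_ne_zero h.marked_right
  -- Some translate of the bridging arc lies to the right of `u` and separates it from `posInf`.
  have key : ∀ j, IsLeftOf (i + j * n) (k + j * m) u → False := fun j hj =>
    (h.shift j).not_separate hn hT h' (side_lower_upper_neg hn hj)
      (side_lower_upper_pos hn trivial)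
  cases u with
  | lower a =>
    obtain ⟨j, hj⟩ := exists_lt_mul hn i a
    exact key j hj
  | upper a =>
    obtain ⟨j, hj⟩ := exists_lt_mul hm k a
    exact key j hj
  | posInf => exact h'.isArcPair.ne rfl
  | negInf => exact key 0 trivial

theorem Edge.not_negInf (hn : 0 < n) (hT : IsTriangulation T) {i k : ℤ} {u : Vertex}
    (h : Edge T (.lower i) (.upper k)) (h' : Edge T u .negInf) : False := by
  have hm := Nat.pos_of_ne_zero h.marked_right
  have key : ∀ j, IsRightOf (i + j * n) (k + j * m) u → False := fun j hj =>
    (h.shift j).not_separate hn hT h'.symm (side_lower_upper_neg hn trivial)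
      (side_lower_upper_pos hn hj)
  cases u with
  | lower a =>
    obtain ⟨j, hj⟩ := exists_mul_lt hn i a
    exact key j hj
  | upper a =>
    obtain ⟨j, hj⟩ := exists_mul_lt hm k a
    exact key j hj
  | negInf => exact h'.isArcPair.ne rfl
  | posInf => exact key 0 trivial

/-- A translate of the first arc that starts to the left of `k` separates `lower k` from `negInf`.
-/
theorem Edge.not_posInf_of_negInf (hn : 0 < n) (hT : IsTriangulation T) {i k : ℤ}
    (h : Edge T (.lower i) .posInf) (h' : Edge T (.lower k) .negInf) : False := by
  obtain ⟨j, hj⟩ := exists_mul_lt hn i k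
  exact (h.shift j).not_separate hn hT h' (side_lower_posInf_neg hj)
    (side_lower_posInf_pos (by simp) (by simp))

theorem isArcPair_lower_posInf (i : ℤ) : IsArcPair m (.lower i) .posInf :=
  ⟨Or.inr (Or.inl ⟨trivial, trivial⟩), by simp, id⟩

theorem isArcPair_lower_negInf (i : ℤ) : IsArcPair m (.lower i) .negInf :=
  ⟨Or.inr (Or.inl ⟨trivial, trivial⟩), by simp, id⟩

/-- Translates share the end `posInf` and do not cross. Without bridging arcs and arcs to `negInf`,
an edge that crosses the pair has two lower ends and passes over `p`. -/
theorem edge_posInf (hn : 0 < n) (hT : IsTriangulation T) {p : ℤ}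
    (hp : covers (LowerJoined T) p = ∅) (hb : ∀ i k, ¬ Edge T (.lower i) (.upper k))
    (hneg : ∀ i, ¬ Edge T (.lower i) .negInf) : Edge T (.lower p) .posInf := by
  refine edge_of_not_separate hn hT (isArcPair_lower_posInf p) (fun j => ?_) fun x y hxy hx hy => ?_
  · rw [crossing_eq_side, show Vertex.posInf.shift n m j = .posInf from rfl, side_right, mul_zero]
  · have hx0 : x ≠ .posInf := by rintro rfl; rw [side_right] at hx; exact hx.false
    have hx1 : ∃ k, x = .lower k ∧ p ≤ k := by
      by_contra! h0
      exact (side_lower_posInf_pos hx0 h0).not_gt hx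
    obtain ⟨k, rfl, hpk⟩ := hx1
    have hpk' : p < k := hpk.lt_of_ne (by rintro rfl; rw [side_left] at hx; exact hx.false)
    cases y with
    | lower l =>
      refine not_lower_edge_of_covers_eq_empty hp hxy.symm (not_le.1 fun hl => ?_) hpk'
      rcases hl.eq_or_lt with rfl | hl
      · rw [side_left] at hy; exact hy.false
      · exact (side_lower_posInf_neg hl).not_gt hy
    | upper l => exact hb _ _ hxy
    | posInf => rw [side_right] at hy; exact hy.false
    | negInf => exact hneg _ hxy

theorem edge_negInf (hn : 0 < n) (hT : IsTriangulation T) {p : ℤ}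
    (hp : covers (LowerJoined T) p = ∅) (hb : ∀ i k, ¬ Edge T (.lower i) (.upper k))
    (hpos : ∀ i, ¬ Edge T (.lower i) .posInf) : Edge T (.lower p) .negInf := by
  refine edge_of_not_separate hn hT (isArcPair_lower_negInf p) (fun j => ?_) fun x y hxy hx hy => ?_
  · rw [crossing_eq_side, show Vertex.negInf.shift n m j = .negInf from rfl, side_right, mul_zero]
  · have hx0 : x ≠ .negInf := by rintro rfl; rw [side_right] at hx; exact hx.false
    have hx1 : ∃ k, x = .lower k ∧ k ≤ p := by
      by_contra! h0
      exact (side_lower_negInf_pos hx0 h0).not_gt hx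
    obtain ⟨k, rfl, hpk⟩ := hx1
    have hpk' : k < p := hpk.lt_of_ne (by rintro rfl; rw [side_left] at hx; exact hx.false)
    cases y with
    | lower l =>
      refine not_lower_edge_of_covers_eq_empty hp hxy hpk' (not_le.1 fun hl => ?_)
      rcases hl.eq_or_lt with rfl | hl
      · rw [side_left] at hy; exact hy.false
      · exact (side_lower_negInf_neg hl).not_gt hy
    | upper l => exact hb _ _ hxy
    | negInf => rw [side_right] at hy; exact hy.false
    | posInf => exact hpos _ hxy

/-- A bridging arc `(x, k)` can be moved to `(q, k)` with `x ≤ q` if no arc passes over `q` and the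
bridging arcs to the left of `q` end to the left of `k`. -/
theorem edge_upper (hn : 0 < n) (hT : IsTriangulation T) {q x k : ℤ}
    (hq : covers (LowerJoined T) q = ∅) (hxk : Edge T (.lower x) (.upper k)) (hxq : x ≤ q)
    (hmax : ∀ a b, a < q → Edge T (.lower a) (.upper b) → b ≤ k) :
    Edge T (.lower q) (.upper k) := by
  have hm := Nat.pos_of_ne_zero hxk.marked_right
  refine edge_of_not_separate hn hT ⟨Or.inl ⟨trivial, hm.ne'⟩, by simp, id⟩ (fun j => ?_)
    fun a b hab ha hb => ?_
  · rw [crossing_eq_side]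
    have hn' : (0 : ℤ) < n := by exact_mod_cast hn
    have hm' : (0 : ℤ) < m := by exact_mod_cast hm
    rcases lt_trichotomy j 0 with hj | rfl | hj
    · refine (mul_pos_of_neg_of_neg (side_lower_upper_neg hn ?_) (side_lower_upper_neg hn ?_)).le
      · have := mul_neg_of_neg_of_pos hj hn'
        exact (by omega : q + j * n < q)
      · have := mul_neg_of_neg_of_pos hj hm'
        exact (by omega : k + j * m < k)
    · rw [Vertex.shift_zero, side_left, zero_mul]
    · refine (mul_pos (side_lower_upper_pos hn ?_) (side_lower_upper_pos hn ?_)).le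
      · have := mul_pos hj hn'
        exact (by omega : q < q + j * n)
      · have := mul_pos hj hm'
        exact (by omega : k < k + j * m)
  -- A crossing edge between lower vertices passes over `q`; one from the lower left to the upper
  -- right contradicts `hmax`; the others starting on the upper boundary cross `(x, k)`, and
  -- asymptotic ones cannot coexist with it.
  · have ha' := isLeftOf_of_side_neg hn ha
    have hb' := isRightOf_of_side_pos hn hb
    cases a with
    | posInf => exact ha'
    | negInf => exact hxk.not_negInf hn hT hab.symm
    | lower a =>
      cases b with
      | negInf => exact hb'
      | posInf => exact hxk.not_posInf hn hT hab
      | lower b => exact not_lower_edge_of_covers_eq_empty hq hab ha' hb'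
      | upper b => exact (hmax a b ha' hab).not_gt hb'
    | upper a =>
      cases b with
      | negInf => exact hb'
      | posInf => exact hxk.not_posInf hn hT hab
      | lower b => exact (hxk.upper_le_upper hn hT hab.symm (lt_of_le_of_lt hxq hb')).not_gt ha'
      | upper b =>
        exact hxk.not_separate hn hT hab (side_lower_upper_neg hn ha') (side_lower_upper_pos hn hb')

/-- An edge of the lower boundary that no arc passes over has a triangle above it. -/
theorem exists_upper_triangle (hn : 0 < n) (hT : IsTriangulation T) {l p : ℤ}
    (hlp : LowerJoined T l p) (hl : covers (LowerJoined T) l = ∅)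
    (hp : covers (LowerJoined T) p = ∅) :
    ∃ z : Vertex, (∀ k, z ≠ .lower k) ∧ Edge T (.lower l) z ∧ Edge T (.lower p) z := by
  by_cases hb : ∃ i k, Edge T (.lower i) (.upper k)
  · obtain ⟨i, k, hik⟩ := hb
    obtain ⟨j, hj⟩ := exists_mul_lt hn i l
    obtain ⟨j', hj'⟩ := exists_lt_mul hn i l
    -- The apex is the rightmost upper vertex joined to some `x ≤ l`; a translated bridging arc
    -- bounds the candidates. It serves `p` as well, because no bridging arc starts strictly between
    -- `l` and `p`.
    obtain ⟨k, ⟨x, hxl, hxk⟩, hmax⟩ := Int.exists_greatest_of_bdd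
      (P := fun k => ∃ x ≤ l, Edge T (.lower x) (.upper k))
      ⟨k + j' * m, fun z ⟨x, hx, hxz⟩ => hxz.upper_le_upper hn hT (hik.shift j') (by omega)⟩
      ⟨k + j * m, i + j * n, hj.le, hik.shift j⟩
    refine ⟨.upper k, by simp, edge_upper hn hT hl hxk hxl fun a b ha hab => hmax b ⟨a, ha.le, hab⟩,
      edge_upper hn hT hp hxk (hxl.trans hlp.1.le) fun a b ha hab => ?_⟩
    rcases le_or_gt a l with hal | hal
    · exact hmax b ⟨a, hal, hab⟩
    · obtain ⟨c, hc, -⟩ := hlp.exists_lower hn hT hab hal ha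
      simp at hc
  · push Not at hb
    -- Without bridging arcs, asymptotic arcs at the lower boundary all spiral the same way, and
    -- that end is the apex; if none goes to `negInf`, maximality supplies those to `posInf`.
    by_cases hneg : ∃ i, Edge T (.lower i) .negInf
    · obtain ⟨i, hi⟩ := hneg
      have hpos : ∀ k, ¬ Edge T (.lower k) .posInf := fun k hk => hk.not_posInf_of_negInf hn hT hi
      exact ⟨.negInf, by simp, edge_negInf hn hT hl hb hpos, edge_negInf hn hT hp hb hpos⟩
    · push Not at hneg
      exact ⟨.posInf, by simp, edge_posInf hn hT hl hb hneg, edge_posInf hn hT hp hb hneg⟩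

end lower

/-! ## Counting triangles -/

section counting

variable {n m : ℕ} {T : Set (Arc n m)}

/-- All bridging arcs at `p` are squeezed between the two neighbouring translates of one of them. -/
theorem finite_upper_neighbours (hn : 0 < n) (hT : IsTriangulation T) (p : ℤ) :
    {k | Edge T (.lower p) (.upper k)}.Finite := by
  rcases Set.eq_empty_or_nonempty {k | Edge T (.lower p) (.upper k)} with h | ⟨k, hk⟩
  · rw [h]; exact Set.finite_empty
  · have hk : Edge T (.lower p) (.upper k) := hk
    refine (Set.finite_Icc (k - m) (k + m)).subset fun l hl => ⟨?_, ?_⟩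
    · have h1 : Edge T (.lower (p - n)) (.upper (k - m)) := by
        simpa [Vertex.shift, sub_eq_add_neg] using hk.shift (-1)
      exact h1.upper_le_upper hn hT hl (by omega)
    · have h1 : Edge T (.lower (p + n)) (.upper (k + m)) := by
        simpa [Vertex.shift] using hk.shift 1
      exact Edge.upper_le_upper hn hT hl h1 (by omega)

theorem finite_joined (hn : 0 < n) (hT : IsTriangulation T) (p : ℤ) :
    {v | Joined T (.lower p) v}.Finite := by
  have h := isPeripheralSystem hn hT
  refine ((((Set.finite_Icc (p - n) (p + n)).image Vertex.lower).union
    ((finite_upper_neighbours hn hT p).image Vertex.upper)).union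
    (Set.toFinite {.posInf, .negInf})).subset fun v hv => ?_
  have hv : Joined T (.lower p) v := hv
  cases v with
  | lower k =>
    refine Or.inl (Or.inl ⟨k, ?_, rfl⟩)
    rcases lt_trichotomy p k with hk | rfl | hk
    · exact ⟨by omega, h.le_add ⟨hk, hv⟩⟩
    · exact ⟨by omega, by omega⟩
    · have := h.le_add (i := k) (j := p) ⟨hk, joined_comm.1 hv⟩
      exact ⟨by omega, by omega⟩
  | upper k => exact Or.inl (Or.inr ⟨k, hv.resolve_left id, rfl⟩)
  | posInf => exact Or.inr (Or.inl rfl)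
  | negInf => exact Or.inr (Or.inr rfl)

/-- Needed because `ncard` of an infinite set is `0`, which would ruin the lower bound. -/
theorem finite_trianglesAt (hn : 0 < n) (hT : IsTriangulation T) (p : ℤ) :
    (trianglesAt T (.lower p)).Finite := by
  have h := ((finite_joined hn hT p).insert (.lower p)).finite_subsets
  refine (h.preimage Finset.coe_injective.injOn).subset fun t ht v hv => ?_
  by_cases hvp : v = .lower p
  · exact Or.inl hvp
  · exact Or.inr (ht.2.2 ht.2.1 hv (Ne.symm hvp))

open Classical in
theorem mem_trianglesAt {u v w : Vertex} (huv : u ≠ v) (huw : u ≠ w) (hvw : v ≠ w)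
    (h1 : Joined T u v) (h2 : Joined T u w) (h3 : Joined T v w) :
    ({u, v, w} : Finset Vertex) ∈ trianglesAt T u := by
  refine ⟨Finset.card_eq_three.2 ⟨u, v, w, huv, huw, hvw, rfl⟩, by simp, ?_⟩
  have := joined_comm.1 h1
  have := joined_comm.1 h2
  have := joined_comm.1 h3
  intro x hx y hy hxy
  simp only [Finset.coe_insert, Finset.coe_singleton, Set.mem_insert_iff,
    Set.mem_singleton_iff] at hx hy
  rcases hx with rfl | rfl | rfl <;> rcases hy with rfl | rfl | rfl <;>
    first | assumption | exact absurd rfl hxy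

open Classical in
/-- A fan of triangles at `p` with the vertices `x` and `f x` for `x ∈ S`. -/
theorem card_le_ncard_of_fan {A : Set (Finset Vertex)} (hA : A.Finite) {p : ℤ} {S : Finset ℤ}
    {f : ℤ → ℤ} (hf : ∀ x ∈ S, ({.lower p, .lower x, .lower (f x)} : Finset Vertex) ∈ A)
    (hp : ∀ x ∈ S, x ≠ p) (h : ∀ x ∈ S, ∀ y ∈ S, x = f y → y = f x → x = y) :
    S.card ≤ A.ncard := by
  have hinj : Set.InjOn (fun x : ℤ => ({.lower p, .lower x, .lower (f x)} : Finset Vertex)) S := by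
    intro x hx y hy hxy
    simp only at hxy
    have h1 : Vertex.lower x ∈ ({.lower p, .lower y, .lower (f y)} : Finset Vertex) := by
      rw [← hxy]; simp
    have h2 : Vertex.lower y ∈ ({.lower p, .lower x, .lower (f x)} : Finset Vertex) := by
      rw [hxy]; simp
    simp only [Finset.mem_insert, Finset.mem_singleton, Vertex.lower.injEq] at h1 h2
    rcases h1 with h1 | h1 | h1
    · exact absurd h1 (hp x hx)
    · exact h1
    rcases h2 with h2 | h2 | h2
    · exact absurd h2 (hp y hy)
    · exact h2.symm
    · exact h x hx y hy h1 h2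
  rw [← Set.ncard_coe_finset]
  exact Set.ncard_le_ncard_of_injOn _ hf hinj hA

/-- The weights of the peripheral system are a supersolution of the difference equation whose
coefficients are the numbers of triangles. -/
theorem weight_add_weight_le (hn : 0 < n) (hT : IsTriangulation T) (p : ℤ) :
    (isPeripheralSystem hn hT).weight (p - 1) + (isPeripheralSystem hn hT).weight (p + 1) ≤
      (trianglesAt T (.lower p)).ncard * (isPeripheralSystem hn hT).weight p := by
  classical
  set h := isPeripheralSystem hn hT
  obtain ⟨l, r, S, R, f, g, hl, hr, hS, hR, hlr⟩ := h.exists_fans p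
  set A := trianglesAt T (.lower p) with hA
  have hAfin : A.Finite := finite_trianglesAt hn hT p
  -- Triangles with both other vertices on the lower left, on the lower right, and all others are
  -- counted separately: the fans supply the first two kinds, the triangles over `p` or above its
  -- longest arcs the third.
  set L := {t ∈ A | ∀ v ∈ t, v ≠ .lower p → ∃ k < p, v = .lower k} with hL
  set M := {t ∈ A | ∀ v ∈ t, v ≠ .lower p → ∃ k > p, v = .lower k} with hM
  have hLA : L ⊆ A := Set.sep_subset _ _
  have hMA : M ⊆ A := Set.sep_subset _ _
  have hSL : S.card ≤ L.ncard := by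
    refine card_le_ncard_of_fan (hAfin.subset hLA) (p := p) (f := f) (fun x hx => ?_)
      (fun x hx => (h.lt (hS x hx).2.2).ne) fun x hx y hy h1 h2 => ?_
    · obtain ⟨h1, h2, h3⟩ := hS x hx
      have h1' := h1.1
      have h2' := h2.1
      have h3' := h3.1
      refine ⟨mem_trianglesAt (by simp; omega) (by simp; omega) (by simp; omega)
        (joined_comm.1 h3.2) (joined_comm.1 h2.2) (joined_comm.1 h1.2), fun v hv hvp => ?_⟩
      simp only [Finset.mem_insert, Finset.mem_singleton] at hv
      rcases hv with rfl | rfl | rfl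
      · exact absurd rfl hvp
      · exact ⟨x, h3', rfl⟩
      · exact ⟨f x, h2', rfl⟩
    · have := (hS x hx).1.1
      have := (hS y hy).1.1
      omega
  have hRM : R.card ≤ M.ncard := by
    refine card_le_ncard_of_fan (hAfin.subset hMA) (p := p) (f := g) (fun x hx => ?_)
      (fun x hx => (h.lt (hR x hx).2.2).ne') fun x hx y hy h1 h2 => ?_
    · obtain ⟨h1, h2, h3⟩ := hR x hx
      have h1' := h1.1
      have h2' := h2.1
      have h3' := h3.1
      refine ⟨mem_trianglesAt (by simp; omega) (by simp; omega) (by simp; omega)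
        h3.2 h2.2 h1.2, fun v hv hvp => ?_⟩
      simp only [Finset.mem_insert, Finset.mem_singleton] at hv
      rcases hv with rfl | rfl | rfl
      · exact absurd rfl hvp
      · exact ⟨x, h3', rfl⟩
      · exact ⟨g x, h2', rfl⟩
    · have := (hR x hx).1.1
      have := (hR y hy).1.1
      omega
  have hdisj : Disjoint L M := by
    refine Set.disjoint_left.2 fun t ht ht' => ?_
    obtain ⟨v, hv, hvp⟩ := Finset.exists_mem_ne (by rw [ht.1.1]; omega) (Vertex.lower p)
    obtain ⟨k, hk, rfl⟩ := ht.2 v hv hvp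
    obtain ⟨k', hk', e⟩ := ht'.2 _ hv hvp
    simp only [Vertex.lower.injEq] at e
    omega
  have hsum : L.ncard + M.ncard + (A \ (L ∪ M)).ncard = A.ncard := by
    rw [← Set.ncard_union_eq hdisj (hAfin.subset hLA) (hAfin.subset hMA), add_comm,
      Set.ncard_sdiff_add_ncard_of_subset (Set.union_subset hLA hMA) hAfin]
  have hwp := h.weight_pos p
  have hlp := h.lt hl
  have hrp := h.lt hr
  have notMem : ∀ t ∈ A, (∃ v ∈ t, v ≠ .lower p ∧ ∀ k < p, v ≠ .lower k) →
      (∃ v ∈ t, v ≠ .lower p ∧ ∀ k > p, v ≠ .lower k) → t ∈ A \ (L ∪ M) := by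
    rintro t ht ⟨v, hv, hvp, hv'⟩ ⟨w, hw, hwp, hw'⟩
    refine ⟨ht, ?_⟩
    rintro (h1 | h1)
    · obtain ⟨k, hk, e⟩ := h1.2 v hv hvp
      exact hv' k hk e
    · obtain ⟨k, hk, e⟩ := h1.2 w hw hwp
      exact hw' k hk e
  have hfin : (A \ (L ∪ M)).Finite := hAfin.subset Set.sdiff_subset
  rcases hlr with ⟨hlr, hw⟩ | ⟨⟨hp0, hl0, hr0⟩, hw⟩ <;> rw [hw] <;>
    refine mul_le_mul_of_nonneg_right ?_ hwp.le
  · have : 0 < (A \ (L ∪ M)).ncard := by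
      refine (Set.ncard_pos hfin).2 ⟨{.lower p, .lower l, .lower r}, notMem _ ?_ ?_ ?_⟩
      · exact mem_trianglesAt (by simp; omega) (by simp; omega) (by simp; omega)
          (joined_comm.1 hl.2) hr.2 hlr.2
      · exact ⟨.lower r, by simp, by simp; omega, fun k hk => by simp; omega⟩
      · exact ⟨.lower l, by simp, by simp; omega, fun k hk => by simp; omega⟩
    have := hsum
    omega
  · obtain ⟨y, hy, hly, hpy⟩ := exists_upper_triangle hn hT hl hl0 hp0
    obtain ⟨z, hz, hpz, hrz⟩ := exists_upper_triangle hn hT hr hp0 hr0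
    -- The two triangles differ, since only the first one contains `lower l`.
    have : 1 < (A \ (L ∪ M)).ncard := by
      refine (Set.one_lt_ncard hfin).2 ⟨{.lower p, .lower l, y}, notMem _ ?_ ?_ ?_,
        {.lower p, .lower r, z}, notMem _ ?_ ?_ ?_, fun e => ?_⟩
      · exact mem_trianglesAt (by simp; omega) (hy _).symm (hy _).symm
          (joined_comm.1 hl.2) (Or.inr hpy) (Or.inr hly)
      · exact ⟨y, by simp, hy _, fun k _ => hy k⟩
      · exact ⟨y, by simp, hy _, fun k _ => hy k⟩
      · exact mem_trianglesAt (by simp; omega) (hz _).symm (hz _).symm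
          hr.2 (Or.inr hpz) (Or.inr hrz)
      · exact ⟨z, by simp, hz _, fun k _ => hz k⟩
      · exact ⟨z, by simp, hz _, fun k _ => hz k⟩
      · have : Vertex.lower l ∈ ({.lower p, .lower r, z} : Finset Vertex) := by
          rw [← e]; simp
        simp only [Finset.mem_insert, Finset.mem_singleton, Vertex.lower.injEq] at this
        rcases this with h1 | h1 | h1
        · omega
        · omega
        · exact hz l h1.symm
    have := hsum
    omega

theorem Joined.shift {u v : Vertex} (h : Joined T u v) (j : ℤ) :
    Joined T (u.shift n m j) (v.shift n m j) :=
  h.imp boundarySegment_shift.2 fun h => Edge.shift h j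

theorem map_shift_mem_trianglesAt {v : Vertex} {t : Finset Vertex} (ht : t ∈ trianglesAt T v)
    (j : ℤ) : t.map ⟨_, Vertex.shift_injective n m j⟩ ∈ trianglesAt T (v.shift n m j) := by
  refine ⟨by rw [Finset.card_map, ht.1], Finset.mem_map_of_mem _ ht.2.1, ?_⟩
  intro x hx y hy hxy
  obtain ⟨x, hx', rfl⟩ := Finset.mem_map.1 hx
  obtain ⟨y, hy', rfl⟩ := Finset.mem_map.1 hy
  exact (ht.2.2 hx' hy' fun e => hxy (by rw [e])).shift j

/-- The number of triangles is invariant under deck transformations. -/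
theorem ncard_trianglesAt_shift (v : Vertex) (j : ℤ) :
    (trianglesAt T (v.shift n m j)).ncard = (trianglesAt T v).ncard := by
  rw [← Set.ncard_image_of_injective (trianglesAt T v)
    (Finset.map_injective ⟨_, Vertex.shift_injective n m j⟩)]
  congr 1
  refine Set.Subset.antisymm (fun t ht => ?_) ?_
  · have := map_shift_mem_trianglesAt ht (-j)
    rw [Vertex.shift_shift, add_neg_cancel, Vertex.shift_zero] at this
    refine ⟨_, this, ?_⟩
    ext x
    simp [Vertex.shift_shift, Vertex.shift_zero]
  · rintro _ ⟨t, ht, rfl⟩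
    exact map_shift_mem_trianglesAt ht j

end counting

end AnnulusFrieze

end

theorem theorem3p7 (n m : ℕ) (hn : 0 < n) (T : Set (AnnulusFrieze.Arc n m))
    (hT : AnnulusFrieze.IsTriangulation T) :
    AnnulusFrieze.DefinesPeriodicInfiniteFrieze (AnnulusFrieze.quiddity T) := by
  obtain ⟨F, hF, hF'⟩ := AnnulusFrieze.exists_isInfiniteFrieze
    -- The shift by one matches the frieze positions `1, …, n` with the lower vertices numbered from
    -- `0`.
    (a := fun p => (AnnulusFrieze.trianglesAt T (.lower (p - 1))).ncard)
    (w := fun p => (AnnulusFrieze.isPeripheralSystem hn hT).weight (p - 1))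
    (fun p => (AnnulusFrieze.isPeripheralSystem hn hT).weight_pos _)
    (fun p => by
      have := AnnulusFrieze.weight_add_weight_le hn hT (p - 1)
      rwa [show p - 1 + 1 = p + 1 - 1 by ring] at this)
  refine ⟨F, hF, fun i => ?_, fun i => ?_⟩
  · rw [hF', hF', ← AnnulusFrieze.ncard_trianglesAt_shift (.lower (i - 1)) 1]
    simp only [AnnulusFrieze.Vertex.shift]
    rw [show i + (n : ℤ) - 1 = i - 1 + 1 * n by ring]
  · rw [hF', add_sub_cancel_right]
    rfl
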